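/- Let $k\ge 2$ and let $G$ be a simple graph with node set $\{0,1,\dots,2k+1\}$ such that $G-0$ (the graph obtained by deleting node $0$) is minimally imperfect, i.e. $G-0$ is not perfect but every graph obtained from it by deleting one node is perfect. Let $\mathrm{STAB}(G)\subseteq\mathbb{R}^{V}$, $V=V(G)$, be the convex hull of the characteristic vectors of the stable sets of $G$, let $\mathrm{FRAC}(G)=\{x\in[0,1]^{V}: x_u+x_v\le 1 \text{ for every edge } uv \text{ of } G\}$, and for a convex set $K\subseteq[0,1]^{V}$ let $\mathrm{cone}(K)=\{(x_0,x_0y): x_0\ge 0,\ y\in K\}\subseteq\mathbb{R}\times\mathbb{R}^{V}$, where the additional coordinate is written first. Let $\mathbf e_*$ be the unit vector of the additional coordinate and $\mathbf e_i$ that of $i\in V$. Let $\mathrm{LS}_+(K)$ be the set of all $x\in[0,1]^{V}$ for which there is a symmetric positive semidefinite real matrix $Y$, with rows and columns indexed by the additional coordinate and $V$, such that $Y\mathbf e_*=\mathrm{diag}(Y)=\binom{1}{x}$ and $Y\mathbf e_i\in\mathrm{cone}(K)$, $Y(\mathbf e_*-\mathbf e_i)\in\mathrm{cone}(K)$ for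 every $i\in V$. The graph $G$ is called $\mathrm{LS}_+$-perfect if $\mathrm{LS}_+(\mathrm{FRAC}(G))=\mathrm{STAB}(G)$. Write $\delta_G(0)$ for the degree of node $0$, $\alpha(G)$ for the maximum cardinality of a stable set of $G$, and $C_{2k+1}$ for the cycle on the nodes $1,\dots,2k+1$ in which $i$ is adjacent to $i+1$ for $1\le i\le 2k$ and $2k+1$ is adjacent to $1$; $\overline{C_{2k+1}}$ is its complement. If $G-0=C_{2k+1}$ and node $0$ has neighbours $v_1<\dots<v_s$ with $s\ge 2$, the central cycles of $G$ are the $s$ cycles formed by node $0$ together with the path of $C_{2k+1}$ running, in the direction of increasing labels, from $v_i$ to $v_{i+1}$ $(1\le i\le s-1)$, respectively from $v_s$ through $2k+1$ and $1$ to $v_1$; a central cycle is odd if it has an odd number of nodes. Then: 1. If $G-0=C_{2k+1}$, then $G$ is $\mathrm{LS}_+$-perfect if and only if either $\delta_G(0)\ge 2$ and $G$ has exactly one odd central cycle, or $\delta_G(0)\in\{0,1,2k+1\}$. 2. If $G-0=\overline{C_{2k+1}}$ and $\alpha(G)=2$, then $G$ is $\mathrm{LS}_+$-perfect if and only if $\delta_G(0)=2k+1$.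 -/

import Mathlib

open SimpleGraph

/-- A finite graph is perfect if each of its induced subgraphs has chromatic number equal to the
size of a maximum cardinality clique in the subgraph. -/
def IsPerfectGraph {V : Type*} (G : SimpleGraph V) : Prop :=
  ∀ U : Set V, (G.induce U).chromaticNumber = ((G.induce U).cliqueNum : ℕ∞)

/-- A graph is minimally imperfect if it is not perfect but deleting any node makes it perfect. -/
def IsMinimallyImperfect {V : Type*} (G : SimpleGraph V) : Prop :=
  ¬ IsPerfectGraph G ∧ ∀ v : V, IsPerfectGraph (G.induce ({v}ᶜ : Set V))

/-- The stable set polytope: the convex hull of the characteristic vectors of stable sets. -/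
def stablePolytope {V : Type*} (G : SimpleGraph V) : Set (V → ℝ) :=
  convexHull ℝ {x | ∃ S : Set V, G.IsIndepSet S ∧ x = S.indicator 1}

/-- The edge relaxation of the stable set polytope. -/
def edgeRelaxation {V : Type*} (G : SimpleGraph V) : Set (V → ℝ) :=
  {x | (∀ v, 0 ≤ x v ∧ x v ≤ 1) ∧ ∀ u v, G.Adj u v → x u + x v ≤ 1}

/-- The homogenization cone of `K`; `none` is the additional coordinate with index zero. -/
def homCone {V : Type*} (K : Set (V → ℝ)) : Set (Option V → ℝ) :=
  {z | ∃ y ∈ K, 0 ≤ z none ∧ ∀ v, z (some v) = z none * y v}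

/-- The lifting `M₊(K)`: positive semidefinite (in particular symmetric) matrices `Y` with
`Y e₀ = diag Y` and `Y eᵢ, Y (e₀ - eᵢ) ∈ cone K` for every `i`. -/
def lsPlusLift {V : Type*} (K : Set (V → ℝ)) : Set (Matrix (Option V) (Option V) ℝ) :=
  {Y | Y.PosSemidef ∧ Y.col none = Y.diag ∧
    ∀ i : V, Y.col (some i) ∈ homCone K ∧ Y.col none - Y.col (some i) ∈ homCone K}

/-- The operator `LS₊` (one application). -/
def lsPlus {V : Type*} (K : Set (V → ℝ)) : Set (V → ℝ) :=
  {x | (∀ v, 0 ≤ x v ∧ x v ≤ 1) ∧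
    ∃ Y ∈ lsPlusLift K, Y none none = 1 ∧ ∀ v, Y (some v) none = x v}

/-- `G` is `LS₊`-perfect if `LS₊`, applied once to the edge relaxation of `G`, gives the stable
set polytope of `G`. -/
def IsLSPlusPerfect {V : Type*} (G : SimpleGraph V) : Prop :=
  lsPlus (edgeRelaxation G) = stablePolytope G

/-- The graph `G - 0` for a graph `G` with node set `{0, …, 2k+1}`.  The node `i` of `G`, where
`1 ≤ i ≤ 2k+1`, is represented by `i - 1 : Fin (2k+1)`. -/
def deleteZero {k : ℕ} (G : SimpleGraph (Fin (2 * k + 2))) : SimpleGraph (Fin (2 * k + 1)) :=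
  G.comap Fin.succ

/-- `w` lies strictly between `u` and `v` on the arc from `u` to `v` of the cycle
`1, 2, …, 2k+1, 1`, traversed in increasing order of the labels. -/
def InsideArc {k : ℕ} (u v w : Fin (2 * k + 2)) : Prop :=
  w ≠ 0 ∧ if u < v then u < w ∧ w < v else u < w ∨ w < v

/-- `v` is the neighbour of `0` that follows the neighbour `u` of `0` in the cyclic order: with
`v₁ < ⋯ < vₛ` the neighbours of `0`, these are the pairs `(vᵢ, vᵢ₊₁)` and `(vₛ, v₁)`. -/
def IsNextNeighbour {k : ℕ} (G : SimpleGraph (Fin (2 * k + 2))) (u v : Fin (2 * k + 2)) : Prop :=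
  G.Adj 0 u ∧ G.Adj 0 v ∧ u ≠ v ∧ ∀ w, G.Adj 0 w → ¬ InsideArc u v w

/-- The central cycles of `G` (meant for graphs in which `G - 0` is the cycle `1, 2, …, 2k+1, 1`
and `0` has at least two neighbours), given by their node sets: a central cycle consists of `0`,
two cyclically consecutive neighbours `u, v` of `0`, and the nodes of the arc from `u` to `v`. -/
def centralCycles {k : ℕ} (G : SimpleGraph (Fin (2 * k + 2))) :
    Set (Set (Fin (2 * k + 2))) :=
  {D | ∃ u v, IsNextNeighbour G u v ∧ D = {w | w = 0 ∨ w = u ∨ w = v ∨ InsideArc u v w}}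

/-- The odd central cycles of `G`: those with an odd number of nodes. -/
def oddCentralCycles {k : ℕ} (G : SimpleGraph (Fin (2 * k + 2))) :
    Set (Set (Fin (2 * k + 2))) :=
  {D | D ∈ centralCycles G ∧ Odd D.ncard}

/-! For bipartite graphs the edge relaxation equals the stable set polytope, so normalized columns
of a lifted matrix lie in that polytope as soon as their supports are bipartite. This gives two
criteria for perfection. If `G - v` is bipartite, `x` is a convex combination of the points given by
`Y e_v` and `Y (e_* - e_v)` (`isLSPlusPerfect_of_bipartite_delete`). If the nonneighbours of every
node induce a bipartite graph, each column `Y e_i` satisfies every inequality `a x ≤ β` with `a ≥ 0`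
valid for stable sets, and the quadratic form of `Y` at `(-β, a)` passes it on to `x`
(`isLSPlusPerfect_of_bipartite_nonneighbors`). The second criterion covers wheels and antiwheels.
The first covers degree at most one, and a unique odd central cycle, where deleting an end of the
odd arc leaves a bipartite graph.

For imperfection, a point violating a valid inequality is built from stable sets tight for it
(`exists_mem_lsPlus_of_tight`): the sum of their rank-one matrices gets total weight slightly above
1 and is corrected in the entries indexed by the additional coordinate and one node `w`. For an
antihole with a missing spoke to `w`, the inequality is `∑ x ≤ 2`, and the tight sets are the edges
of the cycle and `{0, w}`. For the wheel over a cycle of length `2m+1` with exactly one spoke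
missing, it is `∑ rim + (m-1) hub ≤ m`.

The remaining hole case reduces to this punctured wheel. The arcs between consecutive neighbours of
`0` have total length `2k+1`, so some arc is odd; if the odd central cycle is not unique there is a
second one. Reading the cycle from a nonneighbour of `0` that precedes a neighbour, `walk` turns
each rim node into a node of a punctured wheel with `2M+1` rim nodes, `M ≥ 2`, or into the
complement of one. Such a substitution preserves membership in `LS₊` (`literal_mem_lsPlus`), and the
pulled back point violates `∑ rim + (M-1) x_0 ≤ k`, which is valid for `G`
(`sum_mul_indicator_rim_le`). -/

/-! ### The stable set polytope inside the lift. -/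

lemma mem_homCone_edgeRelaxation {V : Type*} {G : SimpleGraph V} {z : Option V → ℝ} :
    z ∈ homCone (edgeRelaxation G) ↔ 0 ≤ z none ∧
      (∀ v, 0 ≤ z (some v) ∧ z (some v) ≤ z none) ∧
      ∀ u v, G.Adj u v → z (some u) + z (some v) ≤ z none := by
  constructor
  · rintro ⟨y, ⟨hy, hy'⟩, h0, hz⟩
    refine ⟨h0, fun v => ?_, fun u v h => ?_⟩
    · rw [hz]
      exact ⟨mul_nonneg h0 (hy v).1, mul_le_of_le_one_right h0 (hy v).2⟩
    · rw [hz, hz, ← mul_add]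
      exact mul_le_of_le_one_right h0 (hy' u v h)
  · rintro ⟨h0, h1, h2⟩
    rcases h0.eq_or_lt with h | h
    · refine ⟨0, ⟨fun v => by simp, fun u v _ => by simp⟩, h0, fun v => ?_⟩
      have := h1 v
      simp only [Pi.zero_apply, mul_zero]
      linarith
    · refine ⟨fun v => z (some v) / z none, ⟨fun v => ⟨div_nonneg (h1 v).1 h0, ?_⟩, ?_⟩, h0, ?_⟩
      · rw [div_le_one h]; exact (h1 v).2
      · intro u v huv
        rw [← add_div, div_le_one h]; exact h2 u v huv
      · intro v; field_simp

lemma convex_homCone_edgeRelaxation {V : Type*} (G : SimpleGraph V) :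
    Convex ℝ (homCone (edgeRelaxation G)) := by
  intro z hz z' hz' a b ha hb _
  rw [mem_homCone_edgeRelaxation] at *
  simp only [Pi.add_apply, Pi.smul_apply, smul_eq_mul]
  refine ⟨by have := hz.1; have := hz'.1; positivity, fun v => ⟨?_, ?_⟩, fun u v h => ?_⟩
  · have := (hz.2.1 v).1; have := (hz'.2.1 v).1; positivity
  · exact add_le_add (mul_le_mul_of_nonneg_left (hz.2.1 v).2 ha)
      (mul_le_mul_of_nonneg_left (hz'.2.1 v).2 hb)
  · have := mul_le_mul_of_nonneg_left (hz.2.2 u v h) ha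
    have := mul_le_mul_of_nonneg_left (hz'.2.2 u v h) hb
    linarith

lemma convex_lsPlus_edgeRelaxation {V : Type*} (G : SimpleGraph V) :
    Convex ℝ (lsPlus (edgeRelaxation G)) := by
  rintro x ⟨hx, Y, ⟨hY, hYd, hYc⟩, hY1, hYx⟩ x' ⟨hx', Y', ⟨hY', hYd', hYc'⟩, hY1', hYx'⟩ a b ha hb hab
  refine ⟨fun v => ?_, a • Y + b • Y', ⟨(hY.smul ha).add (hY'.smul hb), ?_, fun i => ⟨?_, ?_⟩⟩, ?_, ?_⟩
  · have h := hx v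
    have h' := hx' v
    simp only [Pi.add_apply, Pi.smul_apply, smul_eq_mul]
    exact ⟨by nlinarith, by nlinarith⟩
  · ext j
    have h := congrFun hYd j
    have h' := congrFun hYd' j
    simp only [Matrix.col_apply, Matrix.diag_apply, Matrix.add_apply, Matrix.smul_apply] at *
    rw [h, h']
  · exact convex_homCone_edgeRelaxation G (hYc i).1 (hYc' i).1 ha hb hab
  · convert convex_homCone_edgeRelaxation G (hYc i).2 (hYc' i).2 ha hb hab using 1
    ext j
    simp only [Matrix.col_apply, Matrix.add_apply, Matrix.smul_apply, Pi.sub_apply, Pi.add_apply,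
      Pi.smul_apply, smul_eq_mul]
    ring
  · simp [hY1, hY1', hab]
  · intro v
    simp [hYx, hYx']

lemma indicator_mem_lsPlus {V : Type*} [Finite V] {G : SimpleGraph V} {S : Set V}
    (hS : G.IsIndepSet S) :
    S.indicator 1 ∈ lsPlus (edgeRelaxation G) := by
  classical
  have h01 : ∀ v, S.indicator (1 : V → ℝ) v = 0 ∨ S.indicator (1 : V → ℝ) v = 1 := by
    intro v; by_cases h : v ∈ S <;> simp [h]
  have hedge : ∀ u v, G.Adj u v →
      S.indicator (1 : V → ℝ) u + S.indicator (1 : V → ℝ) v ≤ 1 := by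
    intro u v huv
    by_cases h : u ∈ S <;> by_cases h' : v ∈ S <;> simp [h, h']
    exact absurd huv (hS h h' huv.ne)
  set x : V → ℝ := S.indicator 1 with hx
  let z : Option V → ℝ := fun o => o.elim 1 x
  refine ⟨fun v => ?_, Matrix.vecMulVec z (star z),
    ⟨Matrix.posSemidef_vecMulVec_self_star z, ?_, fun i => ⟨?_, ?_⟩⟩, ?_, ?_⟩
  · rcases h01 v with h | h <;> simp [h]
  · ext j
    rcases j with _ | j
    · simp [Matrix.vecMulVec_apply, z]
    · rcases h01 j with h | h <;> simp [Matrix.vecMulVec_apply, z, h]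
  · rw [mem_homCone_edgeRelaxation]
    simp only [Matrix.col_apply, Matrix.vecMulVec_apply, z, Option.elim, star_trivial]
    rcases h01 i with h | h <;> simp only [h, mul_zero, mul_one, le_refl, add_zero, and_self,
      implies_true, zero_le_one, true_and]
    exact ⟨fun v => by rcases h01 v with h | h <;> simp [h], hedge⟩
  · rw [mem_homCone_edgeRelaxation]
    simp only [Matrix.col_apply, Matrix.vecMulVec_apply, z, Option.elim, star_trivial,
      Pi.sub_apply]
    rcases h01 i with h | h <;> simp only [h, mul_zero, mul_one, le_refl, add_zero, and_self,
      implies_true, zero_le_one, true_and, sub_zero, sub_self]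
    exact ⟨fun v => by rcases h01 v with h | h <;> simp [h], hedge⟩
  · simp [Matrix.vecMulVec_apply, z]
  · intro v; simp [Matrix.vecMulVec_apply, z]

lemma stablePolytope_subset_lsPlus {V : Type*} [Finite V] (G : SimpleGraph V) :
    stablePolytope G ⊆ lsPlus (edgeRelaxation G) := by
  refine convexHull_min ?_ (convex_lsPlus_edgeRelaxation G)
  rintro _ ⟨S, hS, rfl⟩
  exact indicator_mem_lsPlus hS

lemma isClosed_stablePolytope {V : Type*} [Finite V] (G : SimpleGraph V) :
    IsClosed (stablePolytope G) := by
  refine Set.Finite.isClosed_convexHull ℝ ?_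
  refine (Set.finite_range (fun S : Set V => S.indicator (1 : V → ℝ))).subset ?_
  rintro _ ⟨S, _, rfl⟩
  exact ⟨S, rfl⟩

lemma indicator_mem_stablePolytope {V : Type*} {G : SimpleGraph V} {S : Set V}
    (hS : G.IsIndepSet S) : S.indicator 1 ∈ stablePolytope G :=
  subset_convexHull ℝ _ ⟨S, hS, rfl⟩

/-! ### Bipartiteness criteria for perfection. -/

/-- A point of the edge relaxation whose support induces a bipartite graph lies in the stable set
polytope: round it with a random threshold. -/
lemma mem_stablePolytope_of_bipartite_support {V : Type*} [Fintype V] {G : SimpleGraph V}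
    {y : V → ℝ} (hy : y ∈ edgeRelaxation G) (c : V → Bool)
    (hc : ∀ u v, G.Adj u v → 0 < y u → 0 < y v → c u ≠ c v) : y ∈ stablePolytope G := by
  classical
  -- The two colour classes read the threshold from opposite ends of the unit interval: `y u + y v ≤
  -- 1` then excludes choosing both ends of an edge, while a uniform `θ` selects `v` with
  -- probability `y v`.
  let S : ℝ → Set V := fun θ => {v | if c v then θ ≤ y v else 1 - y v < θ}
  have hS : ∀ θ ∈ Set.Ioc (0 : ℝ) 1, G.IsIndepSet (S θ) := by
    rintro θ ⟨h0, h1⟩ u hu v hv _ huv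
    have h2 := hy.2 u v huv
    have h3 := hc u v huv
    simp only [S, Set.mem_ofPred_eq] at hu hv
    cases hcu : c u <;> cases hcv : c v <;> simp only [hcu, hcv, if_true, Bool.false_eq_true,
      if_false, ne_eq, not_true, imp_false, not_lt, Bool.true_eq_false, not_false_iff,
      implies_true] at hu hv h3
    · have := h3 (by linarith); linarith
    · linarith
    · linarith
    · have := h3 (by linarith); linarith
  let μ : MeasureTheory.Measure ℝ := MeasureTheory.volume.restrict (Set.Ioc (0 : ℝ) 1)
  have : MeasureTheory.IsProbabilityMeasure μ := ⟨by simp [μ]⟩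
  let T : V → Set ℝ := fun v => if c v then Set.Iic (y v) else Set.Ioi (1 - y v)
  have hT : ∀ v, MeasurableSet (T v) := by
    intro v; simp only [T]; split_ifs <;> measurability
  have hTS : ∀ θ v, (S θ).indicator (1 : V → ℝ) v = (T v).indicator (1 : ℝ → ℝ) θ := by
    intro θ v
    cases hcv : c v <;> simp [S, T, hcv, Set.indicator_apply]
  have hTμ : ∀ v, μ.real (T v) = y v := by
    intro v
    obtain ⟨h0, h1⟩ := hy.1 v
    have : T v ∩ Set.Ioc 0 1 = if c v then Set.Ioc 0 (y v) else Set.Ioc (1 - y v) 1 := by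
      ext θ
      cases hcv : c v <;> simp [T, hcv]
      · grind
      · grind
    rw [MeasureTheory.measureReal_def, MeasureTheory.Measure.restrict_apply (hT v), this]
    split_ifs <;> simp [h0]
  have hint : MeasureTheory.Integrable (fun θ => (S θ).indicator (1 : V → ℝ)) μ := by
    refine MeasureTheory.Integrable.of_eval fun v => ?_
    simp only [hTS]
    exact (MeasureTheory.integrable_const (1 : ℝ)).indicator (hT v)
  have hmem := Convex.integral_mem (μ := μ) (convex_convexHull ℝ _) (isClosed_stablePolytope G)
    (f := fun θ => (S θ).indicator (1 : V → ℝ)) ?_ hint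
  · have hy' : ∫ θ, (S θ).indicator (1 : V → ℝ) ∂μ = y := by
      ext v
      rw [MeasureTheory.eval_integral fun v => hint.eval v]
      simp only [hTS]
      rw [MeasureTheory.integral_indicator_one (hT v), hTμ]
    rwa [hy'] at hmem
  · filter_upwards [MeasureTheory.ae_restrict_mem measurableSet_Ioc] with θ hθ
    exact indicator_mem_stablePolytope (hS θ hθ)

lemma lsPlusLift_symm {V : Type*} {K : Set (V → ℝ)} {Y : Matrix (Option V) (Option V) ℝ}
    (hY : Y ∈ lsPlusLift K) (i j : Option V) : Y i j = Y j i := by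
  have := hY.1.isHermitian.apply i j
  simpa using this.symm

lemma lsPlusLift_diag {V : Type*} {K : Set (V → ℝ)} {Y : Matrix (Option V) (Option V) ℝ}
    (hY : Y ∈ lsPlusLift K) (i : Option V) : Y i i = Y i none :=
  (congrFun hY.2.1 i).symm

/-- A nonzero vector of the cone over the edge relaxation whose normalization is `0/1` at `v` comes
from the stable set polytope if the graph without the closed neighbourhood of `v`, respectively
without `v`, is bipartite. -/
lemma exists_mem_stablePolytope_of_homCone {V : Type*} [Fintype V] {G : SimpleGraph V}
    {z : Option V → ℝ} (hz : z ∈ homCone (edgeRelaxation G)) (v : V) (c : V → Bool)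
    (hv : (z (some v) = z none ∧ ∀ u w, u ≠ v → w ≠ v → ¬ G.Adj u v → ¬ G.Adj w v →
        G.Adj u w → c u ≠ c w) ∨
      (z (some v) = 0 ∧ ∀ u w, u ≠ v → w ≠ v → G.Adj u w → c u ≠ c w)) :
    ∃ y ∈ stablePolytope G, ∀ u, z (some u) = z none * y u := by
  obtain ⟨y, hy, h0, hzy⟩ := hz
  rcases h0.eq_or_lt with h | h
  · refine ⟨_, indicator_mem_stablePolytope (S := ∅) (by simp [SimpleGraph.IsIndepSet]),
      fun u => by rw [hzy, ← h]; simp⟩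
  refine ⟨y, ?_, hzy⟩
  rcases hv with ⟨hv, hc⟩ | ⟨hv, hc⟩
  · have hyv : y v = 1 := by
      rw [hzy] at hv
      exact mul_left_cancel₀ h.ne' (by linarith)
    have hn : ∀ u, 0 < y u → ¬ G.Adj u v := fun u hu huv => by
      have := hy.2 u v huv
      linarith
    refine mem_stablePolytope_of_bipartite_support hy c fun u w huw hu hw => ?_
    exact hc u w (fun e => hn w hw (e ▸ huw.symm)) (fun e => hn u hu (e ▸ huw)) (hn u hu) (hn w hw)
      huw
  · have hyv : y v = 0 := by
      rw [hzy] at hv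
      rcases mul_eq_zero.1 hv with hv | hv
      · linarith
      · exact hv
    refine mem_stablePolytope_of_bipartite_support hy c fun u w huw hu hw => ?_
    exact hc u w (fun e => by subst e; linarith) (fun e => by subst e; linarith) huw

/-- A graph that becomes bipartite by the deletion of a node is `LS₊`-perfect. -/
theorem isLSPlusPerfect_of_bipartite_delete {V : Type*} [Fintype V] {G : SimpleGraph V} (v : V)
    (c : V → Bool) (hc : ∀ u w, u ≠ v → w ≠ v → G.Adj u w → c u ≠ c w) :
    IsLSPlusPerfect G := by
  refine Set.Subset.antisymm ?_ (stablePolytope_subset_lsPlus G)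
  rintro x ⟨hx, Y, hY, hY1, hYx⟩
  have hd := lsPlusLift_diag hY
  have hs := lsPlusLift_symm hY
  obtain ⟨y, hy, hzy⟩ := exists_mem_stablePolytope_of_homCone (hY.2.2 v).1 v c
    (Or.inl ⟨by simp only [Matrix.col_apply, hd]; rw [hs], fun u w hu hw _ _ h => hc u w hu hw h⟩)
  obtain ⟨y', hy', hzy'⟩ := exists_mem_stablePolytope_of_homCone (hY.2.2 v).2 v c
    (Or.inr ⟨by simp only [Matrix.col_apply, Pi.sub_apply, hd, sub_self], hc⟩)
  have hx' : x = x v • y + (1 - x v) • y' := by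
    ext u
    have h1 := hzy u
    have h2 := hzy' u
    simp only [Matrix.col_apply, Pi.sub_apply, hY1, hYx, hs none] at h1 h2
    simp only [Pi.add_apply, Pi.smul_apply, smul_eq_mul]
    linarith
  rw [hx']
  exact convex_convexHull ℝ _ hy hy' (hx v).1 (by linarith [(hx v).2]) (by ring)

lemma sum_mul_le_of_mem_stablePolytope {V : Type*} [Fintype V] {G : SimpleGraph V} {a : V → ℝ}
    {β : ℝ} (h : ∀ S : Set V, G.IsIndepSet S → ∑ v, a v * S.indicator 1 v ≤ β) {y : V → ℝ}
    (hy : y ∈ stablePolytope G) : ∑ v, a v * y v ≤ β := by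
  have : Convex ℝ {y : V → ℝ | ∑ v, a v * y v ≤ β} := by
    intro y hy z hz s t hs ht hst
    have e : ∑ v, a v * (s • y + t • z) v = s * ∑ v, a v * y v + t * ∑ v, a v * z v := by
      rw [Finset.mul_sum, Finset.mul_sum, ← Finset.sum_add_distrib]
      refine Finset.sum_congr rfl fun v _ => ?_
      simp only [Pi.add_apply, Pi.smul_apply, smul_eq_mul]
      ring
    simp only [Set.mem_ofPred_eq] at *
    rw [e]
    have h1 := mul_le_mul_of_nonneg_left hy hs
    have h2 := mul_le_mul_of_nonneg_left hz ht
    have h3 : s * β + t * β = β := by rw [← add_mul, hst, one_mul]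
    linarith
  refine convexHull_min ?_ this hy
  rintro _ ⟨S, hS, rfl⟩
  exact h S hS

/-- The quadratic form of a lifted matrix at `(-β, a)` bounds the valid inequality `a x ≤ β`. -/
lemma sum_mul_le_of_lift {V : Type*} [Fintype V] {K : Set (V → ℝ)}
    {Y : Matrix (Option V) (Option V) ℝ} (hY : Y ∈ lsPlusLift K) (hY1 : Y none none = 1)
    {a : V → ℝ} {β : ℝ} (ha : ∀ v, 0 ≤ a v) (hβ : 0 < β)
    (h : ∀ i, ∑ v, a v * Y (some v) (some i) ≤ β * Y (some i) none) :
    ∑ v, a v * Y (some v) none ≤ β := by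
  have hp := hY.1.dotProduct_mulVec_nonneg (fun o => o.elim (-β) a)
  have hs := lsPlusLift_symm hY
  simp only [dotProduct, Matrix.mulVec, Fintype.sum_option, Pi.star_apply, star_trivial,
    Option.elim, hY1] at hp
  have e1 : ∑ v, Y none (some v) * a v = ∑ v, a v * Y (some v) none :=
    Finset.sum_congr rfl fun v _ => by rw [hs none, mul_comm]
  have e2 : ∑ i, a i * (Y (some i) none * -β + ∑ v, Y (some i) (some v) * a v) ≤ 0 := by
    refine Finset.sum_nonpos fun i _ => mul_nonpos_of_nonneg_of_nonpos (ha i) ?_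
    have : ∑ v, Y (some i) (some v) * a v = ∑ v, a v * Y (some v) (some i) :=
      Finset.sum_congr rfl fun v _ => by rw [hs, mul_comm]
    have := h i
    linarith
  -- The form is `-β (a x - β)` plus the weighted column defects, which `e2` shows to be
  -- nonpositive.
  rw [e1] at hp
  have : -β * (1 * -β + ∑ v, a v * Y (some v) none) ≥ 0 := by linarith
  nlinarith

/-- If all graphs obtained by deleting a node together with its neighbours are bipartite then the
graph is `LS₊`-perfect. -/
theorem isLSPlusPerfect_of_bipartite_nonneighbors {V : Type*} [Fintype V] {G : SimpleGraph V}
    (c : V → V → Bool) (hc : ∀ v u w, u ≠ v → w ≠ v → ¬ G.Adj u v → ¬ G.Adj w v →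
      G.Adj u w → c v u ≠ c v w) : IsLSPlusPerfect G := by
  classical
  refine Set.Subset.antisymm ?_ (stablePolytope_subset_lsPlus G)
  rintro x ⟨hx, Y, hY, hY1, hYx⟩
  by_contra hxS
  obtain ⟨f, β, hfS, hfx⟩ := geometric_hahn_banach_closed_point (convex_convexHull ℝ _)
    (isClosed_stablePolytope G) hxS
  have hf : ∀ y : V → ℝ, f y = ∑ v, f (Pi.single v 1) * y v := by
    intro y
    conv_lhs => rw [← Finset.univ_sum_single y, map_sum]
    refine Finset.sum_congr rfl fun v _ => ?_
    have : Pi.single v (y v) = y v • (Pi.single v 1 : V → ℝ) := by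
      rw [← Pi.single_smul]; simp
    rw [this, map_smul, smul_eq_mul, mul_comm]
  -- Replacing negative coefficients by zero keeps the inequality valid, because stable sets are
  -- closed under passing to subsets, and it does not decrease the left side at `x ≥ 0`.
  set a : V → ℝ := fun v => max (f (Pi.single v 1)) 0 with ha
  have hβ : 0 < β := by
    have := hfS _ (indicator_mem_stablePolytope (S := ∅) (by simp [SimpleGraph.IsIndepSet]))
    rwa [show (∅ : Set V).indicator (1 : V → ℝ) = 0 by ext; simp, map_zero] at this
  have haS : ∀ S : Set V, G.IsIndepSet S → ∑ v, a v * S.indicator 1 v ≤ β := by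
    intro S hS
    have hS' : G.IsIndepSet {v ∈ S | 0 ≤ f (Pi.single v 1)} := hS.mono fun v hv => hv.1
    have := hfS _ (indicator_mem_stablePolytope hS')
    rw [hf] at this
    refine le_of_eq_of_le (Finset.sum_congr rfl fun v _ => ?_) this.le
    by_cases h1 : v ∈ S <;> by_cases h2 : 0 ≤ f (Pi.single v 1)
    · simp [h1, h2, ha]
    · simp [h1, h2, ha, le_of_not_ge h2]
    · simp [h1]
    · simp [h1]
  have hd := lsPlusLift_diag hY
  have hs := lsPlusLift_symm hY
  have key := sum_mul_le_of_lift hY hY1 (a := a) (fun v => le_max_right _ _) hβ ?_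
  · simp only [hYx] at key
    rw [hf] at hfx
    have : ∑ v, f (Pi.single v 1) * x v ≤ ∑ v, a v * x v :=
      Finset.sum_le_sum fun v _ => mul_le_mul_of_nonneg_right (le_max_left _ _) (hx v).1
    linarith
  · intro i
    obtain ⟨y, hy, hzy⟩ := exists_mem_stablePolytope_of_homCone (hY.2.2 i).1 i (c i)
      (Or.inl ⟨by simp only [Matrix.col_apply, hd]; rw [hs], hc i⟩)
    simp only [Matrix.col_apply] at hzy
    have h1 := sum_mul_le_of_mem_stablePolytope haS hy
    have h2 : 0 ≤ Y (some i) none := by rw [hYx]; exact (hx i).1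
    calc ∑ v, a v * Y (some v) (some i) = Y (some i) none * ∑ v, a v * y v := by
          rw [Finset.mul_sum]
          refine Finset.sum_congr rfl fun v _ => ?_
          rw [hzy, hs none]; ring
      _ ≤ _ := by rw [mul_comm β]; exact mul_le_mul_of_nonneg_left h1 h2

/-! ### Violating points from tight stable sets. -/

lemma sum_le_card_sub_one {ι : Type*} [Fintype ι] {g : ι → ℝ} (h : ∀ i, g i ≤ 1) {i₀ : ι}
    (h₀ : g i₀ ≤ 0) : ∑ i, g i ≤ Fintype.card ι - 1 := by
  classical
  have h1 : ∑ i ∈ Finset.univ.erase i₀, g i ≤ ∑ i ∈ Finset.univ.erase i₀, (1 : ℝ) :=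
    Finset.sum_le_sum fun i _ => h i
  rw [Finset.sum_const, Finset.card_erase_of_mem (Finset.mem_univ _), Finset.card_univ,
    nsmul_eq_mul, mul_one, Nat.cast_sub (Fintype.card_pos_iff.2 ⟨i₀⟩), Nat.cast_one] at h1
  rw [← Finset.add_sum_erase _ _ (Finset.mem_univ i₀)]
  linarith

lemma one_le_sum_of_nonneg {ι : Type*} [Fintype ι] {g : ι → ℝ} (h : ∀ i, 0 ≤ g i) {i₀ : ι}
    (h₀ : 1 ≤ g i₀) : 1 ≤ ∑ i, g i :=
  h₀.trans (Finset.single_le_sum (fun i _ => h i) (Finset.mem_univ i₀))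

/-- The parameters of the perturbation in `exists_mem_lsPlus_of_tight`. -/
lemma exists_perturbation_parameters {β M N : ℝ} (hβ : 1 < β) (hM : 0 ≤ M) (hN : 0 < N) :
    ∃ y δ μ : ℝ, 0 < y ∧ 0 < δ ∧ 0 ≤ μ ∧ N * y = 1 + μ ∧ δ ≤ y ∧ μ ≤ δ ∧ δ < μ * β ∧
      ∀ t b c : ℝ, 0 ≤ c → b ^ 2 ≤ M * c → 0 ≤ y * c + (δ - μ) * t ^ 2 - δ * ((1 - 1 / β) * t + b) ^ 2 := by
  set κ : ℝ := 1 - 1 / β with hκ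
  have hβ0 : 0 < β := by linarith
  have hβi : 0 < 1 / β := by positivity
  have hβi1 : 1 / β < 1 := by rw [div_lt_one hβ0]; exact hβ
  have hκ0 : 0 < κ := by linarith
  have hκ1 : κ < 1 := by linarith
  -- `θ` is the ratio `μ / δ`. The violation `δ < μ β` needs `θ > 1 / β = 1 - κ`; positive
  -- semidefiniteness needs `1 - θ > κ ^ 2`. As `κ ^ 2 < κ`, the midpoint serves both. `K` then
  -- comes from completing the square in `(κ t + b) ^ 2`.
  set θ : ℝ := 1 - (κ + κ ^ 2) / 2 with hθ
  have hθ1 : 1 - κ < θ := by nlinarith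
  have hθ2 : θ < 1 - κ ^ 2 := by nlinarith
  set γ : ℝ := 1 - θ - κ ^ 2 with hγ
  have hγ0 : 0 < γ := by linarith
  set K : ℝ := 1 + κ ^ 2 / γ with hK
  have hK0 : 1 ≤ K := by have : 0 ≤ κ ^ 2 / γ := by positivity
                         linarith
  have hθ0 : 0 < θ := by linarith
  have hθ3 : θ ≤ 1 := by nlinarith [sq_nonneg κ]
  -- Small enough that the weight `y ≥ 1 / N` of a single tight set dominates both `δ` and `δ M K`.
  set δ : ℝ := 1 / (N * (1 + M * K)) with hδ
  have hMK : 0 ≤ M * K := by positivity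
  have hδ0 : 0 < δ := by positivity
  have hδN : δ * (1 + M * K) = 1 / N := by rw [hδ]; field_simp
  have hy : 1 / N ≤ (1 + θ * δ) / N := by
    gcongr; nlinarith
  refine ⟨(1 + θ * δ) / N, δ, θ * δ, by positivity, hδ0, by positivity, by field_simp, ?_, ?_, ?_,
    ?_⟩
  · nlinarith
  · nlinarith
  · have : 1 < θ * β := by
      have h : (1 - κ) * β = 1 := by rw [hκ]; field_simp; ring
      nlinarith
    nlinarith
  · intro t b c hc hbc
    have h1 : (κ * t + b) ^ 2 ≤ (1 - θ) * t ^ 2 + K * b ^ 2 := by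
      have : 0 ≤ γ * (t - κ / γ * b) ^ 2 := by positivity
      have e : γ * (t - κ / γ * b) ^ 2 = (1 - θ) * t ^ 2 + K * b ^ 2 - (κ * t + b) ^ 2 := by
        have : γ ≠ 0 := hγ0.ne'
        rw [show (1 - θ) = γ + κ ^ 2 by rw [hγ]; ring, hK]
        field_simp
        ring
      linarith
    have h3 : δ * (K * b ^ 2) ≤ (1 + θ * δ) / N * c := by
      calc δ * (K * b ^ 2) ≤ δ * (K * (M * c)) := by gcongr
        _ = (δ * (M * K)) * c := by ring
        _ ≤ _ := mul_le_mul_of_nonneg_right (by linarith) hc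
    have h4 := mul_le_mul_of_nonneg_left h1 hδ0.le
    nlinarith

/-- Let `F` be a family of stable sets that are tight for the inequality `a x ≤ β`, and let `w` be a
node with `a w = 1`.  If the tight sets determine the value at `w` of the functionals vanishing on
them, and sufficiently many of them avoid given nodes, then a perturbation of the uniform
combination of the tight sets, in the column of `w`, lies in `LS₊` and violates the inequality. -/
theorem exists_mem_lsPlus_of_tight {V ι : Type*} [Fintype V] [DecidableEq V] [Fintype ι]
    {G : SimpleGraph V} {F : ι → Finset V} {a : V → ℝ} {β : ℝ} {w : V} (hβ : 1 < β)
    (haw : a w = 1) (hF : ∀ i, G.IsIndepSet (F i)) (hFa : ∀ i, ∑ v ∈ F i, a v = β)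
    (hker : ∀ (t : ℝ) (x : V → ℝ), (∀ i, t + ∑ v ∈ F i, x v = 0) → x w = -t / β)
    (hw : ∃ i, w ∈ F i)
    (h2 : ∀ j l, j ≠ w → l ≠ w → ∃ i, w ∈ F i ∧ j ∉ F i ∧ l ∉ F i)
    (h3 : ∀ i j l, i ≠ w → j ≠ w → l ≠ w → ∃ f, i ∉ F f ∧ j ∉ F f ∧ l ∉ F f) :
    ∃ x ∈ lsPlus (edgeRelaxation G), β < ∑ v, a v * x v := by
  let χ : ι → V → ℝ := fun i v => if v ∈ F i then 1 else 0
  have hχ1 : ∀ {i v}, v ∈ F i → χ i v = 1 := fun h => if_pos h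
  have hχ0 : ∀ {i v}, v ∉ F i → χ i v = 0 := fun h => if_neg h
  have h01 : ∀ i v, χ i v = 0 ∨ χ i v = 1 := fun i v => by
    by_cases h : v ∈ F i
    · exact Or.inr (hχ1 h)
    · exact Or.inl (hχ0 h)
  have hedge : ∀ i u v, G.Adj u v → χ i u + χ i v ≤ 1 := by
    intro i u v huv
    by_cases hu : u ∈ F i
    · by_cases hv : v ∈ F i
      · exact absurd huv (hF i hu hv huv.ne)
      · rw [hχ0 hv]; rcases h01 i u with h | h <;> linarith
    · rw [hχ0 hu]; rcases h01 i v with h | h <;> linarith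
  have hsum : ∀ (i) (x : V → ℝ), ∑ v ∈ F i, x v = ∑ v, χ i v * x v := by
    intro i x; simp [χ]
  -- the functional `x_w + t / β` is a combination of the tight sets
  obtain ⟨m, hm⟩ : ∃ m : ι → ℝ, ∀ (t : ℝ) (x : V → ℝ),
      ∑ i, m i * (t + ∑ v, χ i v * x v) = x w + t / β := by
    let z : ι → Option V → ℝ := fun i o => o.elim 1 (χ i)
    let L : ι → (Option V → ℝ) →ₗ[ℝ] ℝ := fun i => ∑ o, z i o • LinearMap.proj o
    let K : (Option V → ℝ) →ₗ[ℝ] ℝ := LinearMap.proj (some w) + (1 / β) • LinearMap.proj none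
    have hL : ∀ i x, L i x = x none + ∑ v, χ i v * x (some v) := by
      intro i x; simp [L, z, Fintype.sum_option]
    have hK : ∀ x, K x = x (some w) + x none / β := by
      intro x; simp [K]; ring
    have : K ∈ Submodule.span ℝ (Set.range L) := by
      refine mem_span_of_iInf_ker_le_ker fun x hx => ?_
      simp only [Submodule.mem_iInf, LinearMap.mem_ker, hL] at hx
      rw [LinearMap.mem_ker, hK, hker (x none) (fun v => x (some v)) fun i => by rw [hsum, hx]]
      ring
    rw [Submodule.mem_span_range_iff_exists_fun] at this
    obtain ⟨m, hm⟩ := this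
    refine ⟨m, fun t x => ?_⟩
    have := congrArg (fun f => f (fun o => o.elim t x)) hm
    simpa [hL, hK] using this
  obtain ⟨i₀, hi₀⟩ := hw
  have hN : (0 : ℝ) < Fintype.card ι := by exact_mod_cast Fintype.card_pos_iff.2 ⟨i₀⟩
  obtain ⟨y, δ, μ, hy0, hδ0, hμ0, hNy, hδy, hμδ, hviol, hpsd⟩ :=
    exists_perturbation_parameters (M := ∑ i, m i ^ 2) hβ (by positivity) hN
  let z : ι → Option V → ℝ := fun i o => o.elim 1 (χ i)
  let e : Option V → ℝ := fun o => o.elim 1 fun _ => 0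
  let g : Option V → ℝ := fun o => o.elim 1 fun v => if v = w then 1 else 0
  -- The correction terms lower the entry `(none, none)` by `μ` and the entries `(none, w)`, `(w,
  -- none)`, `(w, w)` by `δ`. The left side of the inequality becomes `(1 + μ) β - δ`.
  let Y : Matrix (Option V) (Option V) ℝ :=
    y • ∑ i, Matrix.vecMulVec (z i) (z i) + (δ - μ) • Matrix.vecMulVec e e -
      δ • Matrix.vecMulVec g g
  have hYapp : ∀ p q, Y p q = y * ∑ i, z i p * z i q + (δ - μ) * (e p * e q) - δ * (g p * g q) := by
    intro p q
    simp [Y, Matrix.sum_apply, Matrix.vecMulVec_apply]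
  have hY00 : Y none none = 1 := by
    rw [hYapp]
    simp [z, e, g]
    linarith
  have hYv0 : ∀ v, Y (some v) none = y * ∑ i, χ i v - if v = w then δ else 0 := by
    intro v; rw [hYapp]; simp [z, e, g]
  have hYuv : ∀ u v, Y (some u) (some v) =
      y * ∑ i, χ i u * χ i v - if u = w ∧ v = w then δ else 0 := by
    intro u v
    rw [hYapp]
    by_cases hu : u = w <;> by_cases hv : v = w <;> simp [z, e, g, hu, hv]
  have hYs : ∀ p q, Y p q = Y q p := by
    intro p q
    rw [hYapp, hYapp]
    simp only [mul_comm]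
  have hYvv : ∀ v, Y (some v) (some v) = Y (some v) none := by
    intro v
    rw [hYuv, hYv0]
    simp only [and_self]
    congr 2
    exact Finset.sum_congr rfl fun i _ => by rcases h01 i v with h | h <;> simp [h]
  have hYpsd : Y.PosSemidef := by
    refine Matrix.PosSemidef.of_dotProduct_mulVec_nonneg ?_ fun x => ?_
    · ext p q
      simpa using hYs q p
    · have hq : star x ⬝ᵥ Y.mulVec x =
          y * ∑ i, (x none + ∑ v, χ i v * x (some v)) ^ 2 + (δ - μ) * (x none) ^ 2 -
            δ * ((1 - 1 / β) * x none + (x (some w) + x none / β)) ^ 2 := by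
        have h1 : ∀ i, z i ⬝ᵥ x = x none + ∑ v, χ i v * x (some v) := by
          intro i; simp [z, dotProduct, Fintype.sum_option]
        have h2 : e ⬝ᵥ x = x none := by simp [e, dotProduct, Fintype.sum_option]
        have h3 : g ⬝ᵥ x = (1 - 1 / β) * x none + (x (some w) + x none / β) := by
          simp [g, dotProduct, Fintype.sum_option]; ring
        rw [dotProduct_comm]
        simp only [Y, star_trivial, Matrix.sub_mulVec, Matrix.add_mulVec, Matrix.smul_mulVec,
          Matrix.sum_mulVec, Matrix.vecMulVec_mulVec, sub_dotProduct, add_dotProduct,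
          smul_dotProduct, sum_dotProduct, h1, h2, h3, smul_eq_mul, op_smul_eq_smul]
        simp only [pow_two]
      rw [hq]
      -- Here `c` is the sum of the squared products with the tight vectors. The combination `m` and
      -- Cauchy–Schwarz bound `(x_w + t / β) ^ 2` by a multiple of `c`.
      refine hpsd _ _ _ (by positivity) ?_
      rw [← hm (x none) fun v => x (some v)]
      exact Finset.sum_mul_sq_le_sq_mul_sq _ _ _
  have mono : ∀ f : ι → ℝ, (∀ i, 0 ≤ f i) → 0 ≤ y * ∑ i, f i := fun f hf =>
    mul_nonneg hy0.le (Finset.sum_nonneg fun i _ => hf i)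
  -- A single tight set with positive slack contributes `y ≥ δ`, enough to pay for a perturbed
  -- entry. In `upper`, one set missing from the count offsets the excess `μ ≤ δ ≤ y`; `upper'`
  -- suffices wherever an entry lowered by `δ` helps the inequality.
  have lower : ∀ f : ι → ℝ, (∀ i, 0 ≤ f i) → (∃ i, 1 ≤ f i) → δ ≤ y * ∑ i, f i := by
    rintro f hf ⟨i, hi⟩
    nlinarith [one_le_sum_of_nonneg hf hi]
  have upper : ∀ f : ι → ℝ, (∀ i, f i ≤ 1) → (∃ i, f i ≤ 0) → y * ∑ i, f i ≤ 1 := by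
    rintro f hf ⟨i, hi⟩
    have := mul_le_mul_of_nonneg_left (sum_le_card_sub_one hf hi) hy0.le
    linarith
  have upper' : ∀ f : ι → ℝ, (∀ i, f i ≤ 1) → y * ∑ i, f i ≤ 1 + δ := by
    intro f hf
    have : ∑ i, f i ≤ Fintype.card ι := by
      simpa using Finset.sum_le_sum (s := Finset.univ) fun i _ => hf i
    have := mul_le_mul_of_nonneg_left this hy0.le
    linarith
  have h0w : ∀ u v, G.Adj u v → ∑ i, χ i u * χ i v = 0 := fun u v huv =>
    Finset.sum_eq_zero fun i _ => by
      have := hedge i u v huv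
      rcases h01 i u with h | h <;> rcases h01 i v with h' | h' <;> rw [h, h'] at this ⊢ <;>
        linarith
  have hww : ∑ i, χ i w * χ i w = ∑ i, χ i w :=
    Finset.sum_congr rfl fun i _ => by rcases h01 i w with h | h <;> simp [h]
  have hcol : ∀ v, Y.col (some v) ∈ homCone (edgeRelaxation G) := by
    intro v
    rw [mem_homCone_edgeRelaxation]
    simp only [Matrix.col_apply, hYs none (some v), hYv0, hYuv]
    by_cases hv : v = w
    · subst hv
      simp only [if_true, and_true]
      refine ⟨?_, fun u => ?_, fun u u' huu => ?_⟩
      · have := lower (fun i => χ i v) (fun i => by rcases h01 i v with h | h <;> simp [h])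
          ⟨i₀, (hχ1 hi₀).ge⟩
        linarith
      · by_cases hu : u = v
        · subst hu
          simp only [if_true, hww]
          have := lower (fun i => χ i u) (fun i => by rcases h01 i u with h | h <;> simp [h])
            ⟨i₀, (hχ1 hi₀).ge⟩
          constructor <;> linarith
        · obtain ⟨i, hi1, hi2, _⟩ := h2 u u hu hu
          have hl := lower (fun i => χ i v - χ i u * χ i v)
            (fun i => by
              rcases h01 i v with h | h <;> rcases h01 i u with h' | h' <;> simp [h, h'])
            ⟨i, by simp [hχ1 hi1, hχ0 hi2]⟩
          have hm := mono (fun i => χ i u * χ i v)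
            (fun i => by
              rcases h01 i v with h | h <;> rcases h01 i u with h' | h' <;> simp [h, h'])
          simp only [Finset.sum_sub_distrib] at hl
          simp only [hu, if_false]
          constructor <;> linarith
      · by_cases hu : u = v
        · subst hu
          have hu' : u' ≠ u := huu.ne'
          simp only [if_true, hu', if_false, h0w u' u huu.symm, hww]
          linarith
        · by_cases hu' : u' = v
          · subst hu'
            simp only [if_true, hu, if_false, h0w u u' huu, hww]
            linarith
          · obtain ⟨i, hi1, hi2, hi3⟩ := h2 u u' hu hu'
            have hl := lower (fun i => χ i v - (χ i u * χ i v + χ i u' * χ i v))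
              (fun i => by
                have := hedge i u u' huu
                rcases h01 i v with h | h <;> simp only [h] <;> linarith)
              ⟨i, by simp [hχ1 hi1, hχ0 hi2, hχ0 hi3]⟩
            simp only [Finset.sum_sub_distrib, Finset.sum_add_distrib] at hl
            simp only [hu, hu', if_false]
            linarith
    · simp only [hv, and_false, if_false, sub_zero]
      refine ⟨mono _ fun i => ?_, fun u => ⟨mono _ fun i => ?_, ?_⟩, fun u u' huu => ?_⟩
      · rcases h01 i v with h | h <;> simp [h]
      · rcases h01 i v with h | h <;> rcases h01 i u with h' | h' <;> simp [h, h']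
      · have hm := mono (fun i => χ i v - χ i u * χ i v)
          (fun i => by
            rcases h01 i v with h | h <;> rcases h01 i u with h' | h' <;> simp [h, h'])
        simp only [Finset.sum_sub_distrib] at hm
        linarith
      · have hm := mono (fun i => χ i v - (χ i u * χ i v + χ i u' * χ i v))
          (fun i => by
            have := hedge i u u' huu
            rcases h01 i v with h | h <;> simp only [h] <;> linarith)
        simp only [Finset.sum_sub_distrib, Finset.sum_add_distrib] at hm
        linarith
  have hle1 : ∀ v u i, χ i v + χ i u - χ i u * χ i v ≤ 1 := fun v u i => by
    rcases h01 i v with h | h <;> rcases h01 i u with h' | h' <;> simp [h, h']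
  have hle1' : ∀ v u u', G.Adj u u' → ∀ i,
      χ i v + χ i u + χ i u' - χ i u * χ i v - χ i u' * χ i v ≤ 1 := fun v u u' huu i => by
    have := hedge i u u' huu
    rcases h01 i v with h | h <;> simp only [h] <;> linarith
  have hcol' : ∀ v, Y.col none - Y.col (some v) ∈ homCone (edgeRelaxation G) := by
    intro v
    rw [mem_homCone_edgeRelaxation]
    simp only [Matrix.col_apply, Pi.sub_apply, hYs none (some v), hYv0, hYuv, hY00]
    by_cases hv : v = w
    · subst hv
      simp only [if_true, and_true]
      refine ⟨?_, fun u => ?_, fun u u' huu => ?_⟩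
      · have := upper' (fun i => χ i v) (fun i => by rcases h01 i v with h | h <;> simp [h])
        linarith
      · have hm := mono (fun i => χ i u - χ i u * χ i v)
          (fun i => by
            rcases h01 i v with h | h <;> rcases h01 i u with h' | h' <;> simp [h, h'])
        have hl := upper' _ (hle1 v u)
        simp only [Finset.sum_sub_distrib, Finset.sum_add_distrib] at hm hl
        constructor <;> linarith
      · have hl := upper' _ (hle1' v u u' huu)
        simp only [Finset.sum_sub_distrib, Finset.sum_add_distrib] at hl
        linarith
    · simp only [hv, and_false, if_false, sub_zero]
      refine ⟨?_, fun u => ?_, fun u u' huu => ?_⟩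
      · obtain ⟨i, hi, _⟩ := h3 v v v hv hv hv
        have := upper (fun i => χ i v) (fun i => by rcases h01 i v with h | h <;> simp [h])
          ⟨i, (hχ0 hi).le⟩
        linarith
      · by_cases hu : u = w
        · obtain ⟨i, hi1, hi2, _⟩ := h2 v v hv hv
          have hm := lower (fun i => χ i u - χ i u * χ i v)
            (fun i => by
              rcases h01 i v with h | h <;> rcases h01 i u with h' | h' <;> simp [h, h'])
            ⟨i, by rw [← hu] at hi1; simp [hχ1 hi1, hχ0 hi2]⟩
          have hl := upper' _ (hle1 v u)
          simp only [Finset.sum_sub_distrib, Finset.sum_add_distrib] at hm hl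
          simp only [hu, if_true] at *
          constructor <;> linarith
        · obtain ⟨i, hi1, hi2, _⟩ := h3 v u u hv hu hu
          have hm := mono (fun i => χ i u - χ i u * χ i v)
            (fun i => by
              rcases h01 i v with h | h <;> rcases h01 i u with h' | h' <;> simp [h, h'])
          have hl := upper _ (hle1 v u) ⟨i, by simp [hχ0 hi1, hχ0 hi2]⟩
          simp only [Finset.sum_sub_distrib, Finset.sum_add_distrib] at hm hl
          simp only [hu, if_false]
          constructor <;> linarith
      · by_cases h : u = w ∨ u' = w
        · have hl := upper' _ (hle1' v u u' huu)
          simp only [Finset.sum_sub_distrib, Finset.sum_add_distrib] at hl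
          have : δ ≤ (if u = w then δ else 0) + if u' = w then δ else 0 := by
            rcases h with h | h <;> simp only [h, if_true] <;> split_ifs <;> linarith
          linarith
        · obtain ⟨hu, hu'⟩ := not_or.1 h
          obtain ⟨i, hi1, hi2, hi3⟩ := h3 v u u' hv hu hu'
          have hl := upper _ (hle1' v u u' huu) ⟨i, by simp [hχ0 hi1, hχ0 hi2, hχ0 hi3]⟩
          simp only [Finset.sum_sub_distrib, Finset.sum_add_distrib] at hl
          simp only [hu, hu', if_false]
          linarith
  refine ⟨fun v => Y (some v) none, ⟨fun v => ?_, Y, ⟨hYpsd, ?_, fun v => ⟨hcol v, hcol' v⟩⟩, hY00,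
    fun v => rfl⟩, ?_⟩
  · have h1 := (mem_homCone_edgeRelaxation.1 (hcol v)).1
    have h2 := (mem_homCone_edgeRelaxation.1 (hcol' v)).1
    simp only [Matrix.col_apply, Pi.sub_apply, hY00, hYs none] at h1 h2
    constructor <;> linarith
  · ext p
    rcases p with _ | v
    · rfl
    · exact (hYvv v).symm
  · have h1 : ∑ v, a v * ∑ i, χ i v = Fintype.card ι * β := by
      simp only [Finset.mul_sum]
      rw [Finset.sum_comm]
      have : ∀ i, ∑ v, a v * χ i v = β := fun i => by
        rw [← hFa i, hsum]
        exact Finset.sum_congr rfl fun v _ => mul_comm _ _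
      simp [this]
    have h2 : ∑ v, a v * Y (some v) none = y * ∑ v, a v * ∑ i, χ i v - δ := by
      simp only [hYv0, mul_sub, Finset.sum_sub_distrib, mul_ite, mul_zero, Finset.sum_ite_eq',
        Finset.mem_univ, if_true, haw, one_mul]
      rw [Finset.mul_sum]
      congr 1
      exact Finset.sum_congr rfl fun v _ => by ring
    rw [h2, h1]
    have : y * (Fintype.card ι * β) = (1 + μ) * β := by rw [← hNy]; ring
    linarith

/-! ### Substitution of literals. -/

/-- The value of a literal (a node or, for the second component `false`, its complement) in a
homogenized vector. -/
def literalValue {V : Type*} (z : Option V → ℝ) (p : V × Bool) : ℝ :=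
  if p.2 then z (some p.1) else z none - z (some p.1)

/-- If the nodes of `G` are represented by literals of `G'` so that adjacent nodes get adjacent
nodes or complementary literals, then points of `LS₊` for `G'` pull back to `G`. -/
theorem literal_mem_lsPlus {V V' : Type*} [Fintype V] [Fintype V'] {G : SimpleGraph V}
    {G' : SimpleGraph V'} (φ : V → V' × Bool)
    (hφ : ∀ u v, G.Adj u v → ((φ u).1 = (φ v).1 ∧ (φ u).2 ≠ (φ v).2) ∨
      ((φ u).2 = true ∧ (φ v).2 = true ∧ G'.Adj (φ u).1 (φ v).1))
    {x : V' → ℝ} (hx : x ∈ lsPlus (edgeRelaxation G')) :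
    (fun v => if (φ v).2 then x (φ v).1 else 1 - x (φ v).1) ∈ lsPlus (edgeRelaxation G) := by
  classical
  obtain ⟨hx01, Y, hY, hY1, hYx⟩ := hx
  have hd := lsPlusLift_diag hY
  have hs := lsPlusLift_symm hY
  let ext : (Option V' → ℝ) → Option V → ℝ := fun z o => o.elim (z none) fun v => literalValue z (φ v)
  let E₀ : Option V → Option V' → ℝ := fun o => o.elim (Pi.single none 1) fun v =>
    if (φ v).2 then Pi.single (some (φ v).1) 1 else Pi.single none 1 - Pi.single (some (φ v).1) 1
  -- The pulled back matrix is `E Y Eᵀ`. A negated literal turns the column `Y e_i` into `Y (e_* -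
  -- e_i)` and conversely, so the two cone conditions are merely exchanged; complementary literals
  -- sum to the homogenizing coordinate, which settles their edges.
  let E : Matrix (Option V) (Option V') ℝ := Matrix.of E₀
  have hE : ∀ z o, E₀ o ⬝ᵥ z = ext z o := by
    intro z o
    rcases o with _ | v
    · simp [E₀, ext]
    · simp only [E₀, ext, literalValue, Option.elim]
      split_ifs <;> simp [sub_dotProduct]
  have hcone : ∀ z ∈ homCone (edgeRelaxation G'), ext z ∈ homCone (edgeRelaxation G) := by
    intro z hz
    rw [mem_homCone_edgeRelaxation] at *
    obtain ⟨h0, h1, h2⟩ := hz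
    refine ⟨h0, fun v => ?_, fun u v huv => ?_⟩
    · have := h1 (φ v).1
      simp only [ext, literalValue, Option.elim]
      split_ifs <;> constructor <;> linarith
    · simp only [ext, literalValue, Option.elim]
      rcases hφ u v huv with ⟨h3, h4⟩ | ⟨h3, h4, h5⟩
      · rw [h3]
        cases hu : (φ u).2 <;> cases hv : (φ v).2 <;> simp_all
      · simpa [h3, h4] using h2 _ _ h5
  have hYE : ∀ o o', (E * Y * E.transpose) o o' = ext (fun j => ext (Y j) o') o := by
    intro o o'
    calc (E * Y * E.transpose) o o' = (E * (Y * E.transpose)) o o' := by rw [Matrix.mul_assoc]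
      _ = E₀ o ⬝ᵥ fun j => Y j ⬝ᵥ E₀ o' := rfl
      _ = ext (fun j => Y j ⬝ᵥ E₀ o') o := hE _ _
      _ = _ := congrArg (ext · o) (funext fun j => (dotProduct_comm _ _).trans (hE _ _))
  have hnone : (fun j => ext (Y j) none) = Y.col none := rfl
  have hsome : ∀ v, (fun j => ext (Y j) (some v)) =
      if (φ v).2 then Y.col (some (φ v).1) else Y.col none - Y.col (some (φ v).1) := by
    intro v
    ext j
    simp only [ext, literalValue, Option.elim]
    split_ifs <;> rfl
  have hcolE : ∀ o, (E * Y * E.transpose).col o = ext fun j => ext (Y j) o := by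
    intro o
    ext o'
    rw [Matrix.col_apply, hYE]
  have hsub : ∀ z z' : Option V' → ℝ, ext z - ext z' = ext (z - z') := by
    intro z z'
    ext o
    rcases o with _ | v
    · rfl
    · simp only [ext, literalValue, Option.elim, Pi.sub_apply]
      split_ifs <;> ring
  refine ⟨fun v => ?_, E * Y * E.transpose, ⟨?_, ?_, fun v => ⟨?_, ?_⟩⟩, ?_, fun v => ?_⟩
  · have := hx01 (φ v).1
    dsimp only
    split_ifs <;> constructor <;> linarith
  · rw [← Matrix.conjTranspose_eq_transpose_of_trivial]
    exact hY.1.mul_mul_conjTranspose_same E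
  · ext o
    rw [Matrix.col_apply, Matrix.diag_apply, hYE, hYE]
    rcases o with _ | v
    · rfl
    · rw [hsome, hnone]
      simp only [ext, literalValue, Option.elim]
      split_ifs <;> simp only [Matrix.col_apply, Pi.sub_apply, hd, hs none]
      ring
  · rw [hcolE, hsome]
    refine hcone _ ?_
    split_ifs
    · exact (hY.2.2 _).1
    · exact (hY.2.2 _).2
  · rw [hcolE, hcolE, hsome, hnone, hsub]
    refine hcone _ ?_
    split_ifs
    · exact (hY.2.2 _).2
    · rw [sub_sub_cancel]
      exact (hY.2.2 _).1
  · rw [hYE]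
    exact hY1
  · rw [hYE, hnone]
    simp only [ext, literalValue, Option.elim, Matrix.col_apply, hY1, hYx]

/-! ### Tight families with a hub. -/

/-- A version of `exists_mem_lsPlus_of_tight` for families of tight sets in which `{h, w}` is the
only one containing the node `h`. -/
theorem exists_mem_lsPlus_of_tight_hub {V ι : Type*} [Fintype V] [DecidableEq V] [Fintype ι]
    {G : SimpleGraph V} {F : Option ι → Finset V} {a : V → ℝ} {β : ℝ} {h w : V} (hβ : 1 < β)
    (haw : a w = 1) (hF : ∀ i, G.IsIndepSet (F i)) (hFa : ∀ i, ∑ v ∈ F i, a v = β)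
    (hker : ∀ (t : ℝ) (x : V → ℝ), (∀ i, t + ∑ v ∈ F (some i), x v = 0) → x w = -t / β)
    (hnone : F none = {h, w}) (hsome : ∀ i, h ∉ F (some i)) (hc : ∃ c, c ≠ h ∧ c ≠ w)
    (h2 : ∀ c, c ≠ h → c ≠ w → ∃ i, w ∈ F (some i) ∧ c ∉ F (some i))
    (h3 : ∀ a b, a ≠ h → a ≠ w → b ≠ h → b ≠ w → ∃ i, a ∉ F (some i) ∧ b ∉ F (some i)) :
    ∃ x ∈ lsPlus (edgeRelaxation G), β < ∑ v, a v * x v := by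
  obtain ⟨c, hch, hcw⟩ := hc
  have hwn : w ∈ F none := by simp [hnone]
  -- `{h, w}` avoids all nodes except `h` and `w`, so it witnesses the avoidance conditions unless
  -- `h` is among the nodes to avoid. In that case one of the other sets is taken, all of which
  -- avoid `h`.
  have hn : ∀ v, v ≠ h → v ≠ w → v ∉ F none := fun v hv hv' => by simp [hnone, hv, hv']
  have key2 : ∀ c, c ≠ w → ∃ i, w ∈ F (some i) ∧ c ∉ F (some i) := by
    intro b hb
    by_cases hbh : b = h
    · obtain ⟨i, hi, -⟩ := h2 c hch hcw
      exact ⟨i, hi, hbh ▸ hsome i⟩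
    · exact h2 b hbh hb
  have key3 : ∀ a b, a ≠ w → b ≠ w → ∃ i, a ∉ F (some i) ∧ b ∉ F (some i) := by
    intro a b ha hb
    by_cases hah : a = h
    · obtain ⟨i, -, hi⟩ := key2 b hb
      exact ⟨i, hah ▸ hsome i, hi⟩
    · by_cases hbh : b = h
      · obtain ⟨i, -, hi⟩ := key2 a ha
        exact ⟨i, hi, hbh ▸ hsome i⟩
      · exact h3 a b hah ha hbh hb
  refine exists_mem_lsPlus_of_tight hβ haw hF hFa (fun t x hx => hker t x fun i => hx (some i))
    ⟨none, hwn⟩ ?_ ?_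
  · intro j l hj hl
    by_cases hjh : j = h
    · obtain ⟨i, hi, hi'⟩ := key2 l hl
      exact ⟨some i, hi, hjh ▸ hsome i, hi'⟩
    · by_cases hlh : l = h
      · obtain ⟨i, hi, hi'⟩ := key2 j hj
        exact ⟨some i, hi, hi', hlh ▸ hsome i⟩
      · exact ⟨none, hwn, hn j hjh hj, hn l hlh hl⟩
  · intro i j l hi hj hl
    by_cases hih : i = h
    · obtain ⟨f, hf, hf'⟩ := key3 j l hj hl
      exact ⟨some f, hih ▸ hsome f, hf, hf'⟩
    · by_cases hjh : j = h
      · obtain ⟨f, hf, hf'⟩ := key3 i l hi hl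
        exact ⟨some f, hf, hjh ▸ hsome f, hf'⟩
      · by_cases hlh : l = h
        · obtain ⟨f, hf, hf'⟩ := key3 i j hi hj
          exact ⟨some f, hf, hf', hlh ▸ hsome f⟩
        · exact ⟨none, hn i hih hi, hn j hjh hj, hn l hlh hl⟩

/-! ### Wheels and antiwheels. -/

lemma fin_val_sub_eq_ite {n : ℕ} (a b : Fin n) :
    (a - b).val = if b.val ≤ a.val then a.val - b.val else a.val + n - b.val := by
  split_ifs with h
  · exact Fin.sub_val_of_le h
  · rw [Fin.coe_sub_iff_lt.2 (not_le.1 h)]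
    omega

lemma fin_val_sub_eq_one_iff {k : ℕ} (hk : 1 ≤ k) (a b : Fin (2 * k + 1)) :
    (a - b).val = 1 ↔ a = b + 1 := by
  have h1 : (1 : Fin (2 * k + 1)).val = 1 := by
    rw [Fin.val_one', Nat.mod_eq_of_lt (by omega)]
  rw [← sub_eq_iff_eq_add', Fin.ext_iff, h1]

lemma fin_val_add_one_eq_ite {k : ℕ} (hk : 1 ≤ k) (a : Fin (2 * k + 1)) :
    (a + 1).val = if a.val = 2 * k then 0 else a.val + 1 := by
  have h1 : (1 : Fin (2 * k + 1)).val = 1 := by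
    rw [Fin.val_one', Nat.mod_eq_of_lt (by omega)]
  have := a.2
  rw [Fin.val_add, h1]
  split_ifs with h
  · rw [h, Nat.mod_self]
  · exact Nat.mod_eq_of_lt (by omega)

lemma cycleGraph_adj_iff {k : ℕ} (hk : 1 ≤ k) (a b : Fin (2 * k + 1)) :
    (cycleGraph (2 * k + 1)).Adj a b ↔ a = b + 1 ∨ b = a + 1 := by
  rw [cycleGraph_adj', fin_val_sub_eq_one_iff hk, fin_val_sub_eq_one_iff hk]

lemma adj_zero_of_degree_eq {k : ℕ} {G : SimpleGraph (Fin (2 * k + 2))} [DecidableRel G.Adj]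
    (h : G.degree 0 = 2 * k + 1) (v : Fin (2 * k + 2)) (hv : v ≠ 0) : G.Adj 0 v := by
  classical
  have h1 : G.neighborFinset 0 ⊆ Finset.univ.erase 0 := fun u hu => by
    rw [mem_neighborFinset] at hu
    exact Finset.mem_erase.2 ⟨hu.ne', Finset.mem_univ u⟩
  have h2 := Finset.eq_of_subset_of_card_le h1 (by
    rw [card_neighborFinset_eq_degree, h, Finset.card_erase_of_mem (Finset.mem_univ _),
      Finset.card_univ, Fintype.card_fin]
    omega)
  rw [← mem_neighborFinset, h2]
  exact Finset.mem_erase.2 ⟨hv, Finset.mem_univ v⟩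

lemma exists_not_adj_zero_of_degree_ne {k : ℕ} {G : SimpleGraph (Fin (2 * k + 2))}
    [DecidableRel G.Adj] (h : G.degree 0 ≠ 2 * k + 1) : ∃ w : Fin (2 * k + 1), ¬ G.Adj 0 w.succ := by
  classical
  by_contra! hw
  apply h
  have : G.neighborFinset 0 = Finset.univ.erase 0 := by
    ext u
    rw [mem_neighborFinset, Finset.mem_erase]
    refine ⟨fun hu => ⟨hu.ne', Finset.mem_univ u⟩, fun hu => ?_⟩
    obtain ⟨i, rfl⟩ := Fin.exists_succ_eq.2 hu.1
    exact hw i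
  rw [← card_neighborFinset_eq_degree, this, Finset.card_erase_of_mem (Finset.mem_univ _),
    Finset.card_univ, Fintype.card_fin]
  omega

/-- The hub has no nonneighbours, and those of a rim node form a path, coloured by the parity of the
cyclic distance to that node. -/
theorem isLSPlusPerfect_of_wheel {k : ℕ} (hk : 2 ≤ k) {G : SimpleGraph (Fin (2 * k + 2))}
    (hG : deleteZero G = cycleGraph (2 * k + 1)) (h0 : ∀ v, v ≠ 0 → G.Adj 0 v) :
    IsLSPlusPerfect G := by
  have hadj : ∀ a b : Fin (2 * k + 1), G.Adj a.succ b.succ ↔ a = b + 1 ∨ b = a + 1 := fun a b => by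
    rw [← cycleGraph_adj_iff (by omega), ← hG]; rfl
  refine isLSPlusPerfect_of_bipartite_nonneighbors
    (fun v u => decide ((v.val + 2 * k + 1 - u.val) % (2 * k + 1) % 2 = 0)) ?_
  intro v u w hu hw huv hwv huw
  have hv0 : v ≠ 0 := fun e => huv (e ▸ (h0 u (e ▸ hu)).symm)
  have hu0 : u ≠ 0 := fun e => huv (e ▸ h0 v hv0)
  have hw0 : w ≠ 0 := fun e => hwv (e ▸ h0 v hv0)
  obtain ⟨v, rfl⟩ := Fin.exists_succ_eq.2 hv0
  obtain ⟨u, rfl⟩ := Fin.exists_succ_eq.2 hu0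
  obtain ⟨w, rfl⟩ := Fin.exists_succ_eq.2 hw0
  rw [hadj] at huv hwv huw
  rw [Fin.succ_inj.ne] at hu hw
  simp only [Fin.ext_iff, fin_val_add_one_eq_ite (show 1 ≤ k by omega), Fin.val_succ, ne_eq,
    decide_eq_decide] at *
  have := u.2
  have := v.2
  have := w.2
  have h1 : (v.val + 1 + 2 * k + 1 - (u.val + 1)) % (2 * k + 1) =
      if u.val ≤ v.val then v.val - u.val else v.val + (2 * k + 1) - u.val := by
    split_ifs with h
    · rw [show v.val + 1 + 2 * k + 1 - (u.val + 1) = v.val - u.val + (2 * k + 1) by omega,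
        Nat.add_mod_right, Nat.mod_eq_of_lt (by omega)]
    · rw [Nat.mod_eq_of_lt (by omega)]; omega
  have h2 : (v.val + 1 + 2 * k + 1 - (w.val + 1)) % (2 * k + 1) =
      if w.val ≤ v.val then v.val - w.val else v.val + (2 * k + 1) - w.val := by
    split_ifs with h
    · rw [show v.val + 1 + 2 * k + 1 - (w.val + 1) = v.val - w.val + (2 * k + 1) by omega,
        Nat.add_mod_right, Nat.mod_eq_of_lt (by omega)]
    · rw [Nat.mod_eq_of_lt (by omega)]; omega
  rw [h1, h2]
  split_ifs at * <;> omega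

/-- A rim node `v` has only its two cycle neighbours as nonneighbours; the colour singles out `v +
1`. -/
theorem isLSPlusPerfect_of_antiwheel {k : ℕ} (hk : 2 ≤ k) {G : SimpleGraph (Fin (2 * k + 2))}
    (hG : deleteZero G = (cycleGraph (2 * k + 1))ᶜ) (h0 : ∀ v, v ≠ 0 → G.Adj 0 v) :
    IsLSPlusPerfect G := by
  classical
  have hadj : ∀ a b : Fin (2 * k + 1), G.Adj a.succ b.succ ↔
      a ≠ b ∧ ¬ (a = b + 1 ∨ b = a + 1) := fun a b => by
    rw [← cycleGraph_adj_iff (by omega), ← compl_adj, ← hG]; rfl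
  refine isLSPlusPerfect_of_bipartite_nonneighbors
    (fun v u => decide (∃ i : Fin (2 * k + 1), v = i.succ ∧ u = (i + 1).succ)) ?_
  intro v u w hu hw huv hwv huw
  have hv0 : v ≠ 0 := fun e => huv (e ▸ (h0 u (e ▸ hu)).symm)
  have hu0 : u ≠ 0 := fun e => huv (e ▸ h0 v hv0)
  have hw0 : w ≠ 0 := fun e => hwv (e ▸ h0 v hv0)
  obtain ⟨v, rfl⟩ := Fin.exists_succ_eq.2 hv0
  obtain ⟨u, rfl⟩ := Fin.exists_succ_eq.2 hu0
  obtain ⟨w, rfl⟩ := Fin.exists_succ_eq.2 hw0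
  rw [hadj] at huv hwv huw
  rw [Fin.succ_inj.ne] at hu hw
  have h1 : u = v + 1 ∨ v = u + 1 := by tauto
  have h2 : w = v + 1 ∨ v = w + 1 := by tauto
  have e : ∀ u : Fin (2 * k + 1),
      (∃ i : Fin (2 * k + 1), v.succ = i.succ ∧ u.succ = (i + 1).succ) ↔ u = v + 1 := by
    intro u
    constructor
    · rintro ⟨i, h, h'⟩
      rw [Fin.succ_inj] at h h'
      rw [h', h]
    · rintro rfl
      exact ⟨v, rfl, rfl⟩
  simp only [e, ne_eq, decide_eq_decide]
  rcases h1 with h1 | h1 <;> rcases h2 with h2 | h2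
  · exact absurd (h1.trans h2.symm) huw.1
  · intro h
    exact huw.1 (h1.trans (h.1 h1).symm)
  · intro h
    exact huw.1 ((h.2 h2).trans h2.symm)
  · exact absurd (add_right_cancel (h1.symm.trans h2)) huw.1

/-! ### Antiholes with a missing spoke. -/

lemma sum_indicator_le_indepNum {V : Type*} [Fintype V] (G : SimpleGraph V) {S : Set V}
    (hS : G.IsIndepSet S) : ∑ v, (1 : ℝ) * S.indicator 1 v ≤ G.indepNum := by
  classical
  have h : ∑ v, (1 : ℝ) * S.indicator 1 v = S.toFinset.card := by
    simp only [Set.indicator_apply, Pi.one_apply, one_mul, Finset.sum_boole]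
    congr 2
    ext v
    simp
  rw [h]
  exact_mod_cast IsIndepSet.card_le_indepNum (t := S.toFinset) (by simpa using hS)

/-- On at least five nodes, the edges `{a+1, a+2}` and `{a+3, a+4}` are disjoint and miss `a`, so
one of them also misses `b`. -/
lemma fin_cycle_exists_avoiding_edge {k : ℕ} (hk : 2 ≤ k) (a b : Fin (2 * k + 1)) :
    ∃ e : Fin (2 * k + 1), e ≠ a ∧ e ≠ b ∧ e + 1 ≠ a ∧ e + 1 ≠ b := by
  have h := fin_val_add_one_eq_ite (show 1 ≤ k by omega)
  have := a.2
  by_cases hb : b = a + 1 ∨ b = a + 1 + 1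
  · refine ⟨a + 1 + 1 + 1, ?_⟩
    simp only [Fin.ext_iff, h, ne_eq] at *
    split_ifs at * <;> omega
  · refine ⟨a + 1, ?_⟩
    simp only [Fin.ext_iff, h, ne_eq] at *
    split_ifs at * <;> omega

open Fin.NatCast Fin.CommRing in
-- The equations make `f` invariant under shifts by 2, hence constant, since `2 (k+1) ≡ 1` modulo
-- `2k+1`.
lemma fin_cycle_constant {k : ℕ} {f : Fin (2 * k + 1) → ℝ} {t : ℝ}
    (h : ∀ e, t + (f e + f (e + 1)) = 0) (w : Fin (2 * k + 1)) : f w = -t / 2 := by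
  have h2 : ∀ e, f (e + 1 + 1) = f e := fun e => by linarith [h e, h (e + 1)]
  have h3 : ∀ m : ℕ, f (w + ((2 * m : ℕ) : Fin (2 * k + 1))) = f w := by
    intro m
    induction m with
    | zero => simp
    | succ m ih =>
      rw [show ((2 * (m + 1) : ℕ) : Fin (2 * k + 1)) = ((2 * m : ℕ) : Fin (2 * k + 1)) + 1 + 1 by
        push_cast; ring, ← add_assoc, ← add_assoc, h2, ih]
  have h4 : ((2 * (k + 1) : ℕ) : Fin (2 * k + 1)) = 1 := by
    rw [Fin.ext_iff, Fin.val_natCast, Fin.val_one', show 2 * (k + 1) = 1 + (2 * k + 1) by ring,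
      Nat.add_mod_right]
  have h5 := h3 (k + 1)
  rw [h4] at h5
  linarith [h w]

theorem not_isLSPlusPerfect_of_antihole {k : ℕ} (hk : 2 ≤ k) {G : SimpleGraph (Fin (2 * k + 2))}
    (hG : deleteZero G = (cycleGraph (2 * k + 1))ᶜ) (hα : G.indepNum = 2) {w : Fin (2 * k + 1)}
    (hw : ¬ G.Adj 0 w.succ) : ¬ IsLSPlusPerfect G := by
  classical
  have hadj : ∀ a b : Fin (2 * k + 1), G.Adj a.succ b.succ ↔
      a ≠ b ∧ ¬ (a = b + 1 ∨ b = a + 1) := fun a b => by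
    rw [← cycleGraph_adj_iff (by omega), ← compl_adj, ← hG]; rfl
  have hv := fin_val_add_one_eq_ite (show 1 ≤ k by omega)
  have hne : ∀ e : Fin (2 * k + 1), e ≠ e + 1 := fun e => by
    rw [ne_eq, Fin.ext_iff, hv]; split_ifs <;> omega
  let F : Option (Fin (2 * k + 1)) → Finset (Fin (2 * k + 2)) := fun o =>
    o.elim {0, w.succ} fun e => {e.succ, (e + 1).succ}
  have hmem : ∀ e a : Fin (2 * k + 1), a.succ ∈ F (some e) ↔ a = e ∨ a = e + 1 := by
    intro e a; simp [F]
  have hsum : ∀ (e : Fin (2 * k + 1)) (x : Fin (2 * k + 2) → ℝ),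
      ∑ v ∈ F (some e), x v = x e.succ + x (e + 1).succ := fun e x =>
    Finset.sum_pair (Fin.succ_inj.ne.2 (hne e))
  suffices h : ∃ x ∈ lsPlus (edgeRelaxation G), (2 : ℝ) < ∑ v, 1 * x v by
    obtain ⟨x, hx, hxs⟩ := h
    intro hp
    rw [hp] at hx
    have := sum_mul_le_of_mem_stablePolytope (a := fun _ => 1) (β := 2) (fun S hS => by
      have := sum_indicator_le_indepNum G hS
      rw [hα] at this
      exact_mod_cast this) hx
    linarith
  refine exists_mem_lsPlus_of_tight_hub (F := F) (a := fun _ => 1) (h := 0) (w := w.succ)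
    (by norm_num) rfl ?_ ?_ ?_ rfl ?_ ⟨(w + 1).succ, Fin.succ_ne_zero _, ?_⟩ ?_ ?_
  · rintro (_ | e)
    · intro a ha b hb hab h
      simp only [F, Option.elim, Finset.coe_insert, Finset.coe_singleton, Set.mem_insert_iff,
        Set.mem_singleton_iff] at ha hb
      rcases ha with rfl | rfl <;> rcases hb with rfl | rfl
      · exact hab rfl
      · exact hw h
      · exact hw h.symm
      · exact hab rfl
    · intro a ha b hb hab h
      simp only [F, Option.elim, Finset.coe_insert, Finset.coe_singleton, Set.mem_insert_iff,
        Set.mem_singleton_iff] at ha hb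
      rcases ha with rfl | rfl <;> rcases hb with rfl | rfl
      · exact hab rfl
      · exact ((hadj _ _).1 h).2 (Or.inr rfl)
      · exact ((hadj _ _).1 h).2 (Or.inl rfl)
      · exact hab rfl
  · rintro (_ | e)
    · simp only [F, Option.elim]
      rw [Finset.sum_pair (Fin.succ_ne_zero w).symm]; norm_num
    · rw [hsum]; norm_num
  · intro t x hx
    refine fin_cycle_constant (f := fun e => x e.succ) (fun e => ?_) w
    rw [← hx e, hsum]
  · intro e
    simp [F, (Fin.succ_ne_zero _).symm]
  · exact Fin.succ_inj.ne.2 (hne w).symm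
  · intro c hc hcw
    obtain ⟨c, rfl⟩ := Fin.exists_succ_eq.2 hc
    rw [Fin.succ_inj.ne] at hcw
    simp only [hmem]
    -- Of the two cycle edges at `w`, one misses `c`.
    by_cases h : c = w + 1
    · refine ⟨w - 1, Or.inr (by simp), ?_⟩
      rw [sub_add_cancel]
      rintro (h' | h')
      · have h2 : w = w - 1 + 1 := by rw [sub_add_cancel]
        rw [← h', h] at h2
        simp only [Fin.ext_iff, hv] at h2
        have := w.2
        split_ifs at h2 <;> omega
      · exact hcw h'
    · exact ⟨w, Or.inl rfl, by tauto⟩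
  · intro a b ha _ hb _
    obtain ⟨a, rfl⟩ := Fin.exists_succ_eq.2 ha
    obtain ⟨b, rfl⟩ := Fin.exists_succ_eq.2 hb
    obtain ⟨e, h1, h2, h3, h4⟩ := fin_cycle_exists_avoiding_edge hk a b
    refine ⟨e, ?_, ?_⟩ <;> rw [hmem] <;> tauto

/-! ### The punctured wheel. -/

/-- The wheel over the cycle with `2m+1` nodes without the spoke from the hub `none` to the node
`0` of the cycle. -/
def puncturedWheel (m : ℕ) : SimpleGraph (Option (Fin (2 * m + 1))) where
  Adj u v := match u, v with
    | some a, some b => (cycleGraph (2 * m + 1)).Adj a b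
    | none, some b => b ≠ 0
    | some a, none => a ≠ 0
    | none, none => False
  symm := ⟨by
    rintro (_ | a) (_ | b) h
    · exact h
    · exact h
    · exact h
    · exact h.symm⟩
  loopless := ⟨by
    rintro (_ | a) h
    · exact h
    · exact h.ne rfl⟩

/-- The maximum stable set of the cycle that misses the edge from `e` to `e + 1`. -/
def cycleStable (m : ℕ) (e : Fin (2 * m + 1)) : Finset (Fin (2 * m + 1)) :=
  Finset.univ.filter fun j => (j - e).val % 2 = 0 ∧ (j - e).val ≠ 0

lemma card_cycleStable (m : ℕ) (e : Fin (2 * m + 1)) : (cycleStable m e).card = m := by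
  have h1 : ∀ m : ℕ, ∑ i ∈ Finset.range (2 * m + 1), (if i % 2 = 0 ∧ i ≠ 0 then 1 else 0) = m := by
    intro m
    induction m with
    | zero => simp
    | succ m ih =>
      rw [show 2 * (m + 1) + 1 = 2 * m + 1 + 1 + 1 by ring, Finset.sum_range_succ,
        Finset.sum_range_succ, ih, if_neg (by omega), if_pos (by omega)]
  rw [cycleStable, Finset.card_filter]
  refine (Equiv.sum_comp (Equiv.subRight e)
    (fun j : Fin (2 * m + 1) => if j.val % 2 = 0 ∧ j.val ≠ 0 then 1 else 0)).trans ?_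
  rw [Fin.sum_univ_eq_sum_range (fun i => if i % 2 = 0 ∧ i ≠ 0 then 1 else 0), h1]

/-- Moving the missed edge forward by two positions exchanges one node for its neighbour. Hence a
functional that vanishes on all these sets has equal coefficients on the rim. -/
lemma sum_cycleStable_sub {m : ℕ} (hm : 1 ≤ m) (e : Fin (2 * m + 1)) (x : Fin (2 * m + 1) → ℝ) :
    ∑ j ∈ cycleStable m e, x j - ∑ j ∈ cycleStable m (e + 1 + 1), x j =
      x (e + 1 + 1) - x (e + 1) := by
  have h1 : ∀ i : Fin (2 * m + 1), x i = ∑ j, if j = i then x j else 0 := by simp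
  rw [h1 (e + 1 + 1), h1 (e + 1), cycleStable, cycleStable, Finset.sum_filter, Finset.sum_filter,
    ← Finset.sum_sub_distrib, ← Finset.sum_sub_distrib]
  refine Finset.sum_congr rfl fun j _ => ?_
  have hj := j.2
  have he := e.2
  have hv := fin_val_add_one_eq_ite hm
  have hd : (j - (e + 1 + 1)).val =
      if 2 ≤ (j - e).val then (j - e).val - 2 else (j - e).val + (2 * m + 1) - 2 := by
    rw [fin_val_sub_eq_ite, fin_val_sub_eq_ite, hv, hv]
    split_ifs <;> omega
  have h2 : j = e + 1 + 1 ↔ (j - e).val = 2 := by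
    rw [fin_val_sub_eq_ite, Fin.ext_iff, hv, hv]
    split_ifs <;> omega
  have h3 : j = e + 1 ↔ (j - e).val = 1 := by
    rw [fin_val_sub_eq_ite, Fin.ext_iff, hv]
    split_ifs <;> omega
  rw [hd]
  simp only [h2, h3]
  generalize (j - e).val = d
  split_ifs <;> first | omega | simp

lemma fin_constant_of_add_one {n : ℕ} {f : Fin (n + 1) → ℝ} (h : ∀ e, f (e + 1) = f e) (i) :
    f i = f 0 := by
  induction i using Fin.induction with
  | zero => rfl
  | succ i ih => rw [← Fin.coeSucc_eq_succ, h, ih]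

lemma isIndepSet_cycleStable {m : ℕ} (hm : 1 ≤ m) (e : Fin (2 * m + 1)) :
    (cycleGraph (2 * m + 1)).IsIndepSet (cycleStable m e) := by
  have key : ∀ a : Fin (2 * m + 1), a ∈ cycleStable m e → a + 1 ∉ cycleStable m e := by
    intro a ha hb
    simp only [cycleStable, Finset.mem_filter, Finset.mem_univ, true_and, fin_val_sub_eq_ite,
      fin_val_add_one_eq_ite hm] at ha hb
    have := a.2
    have := e.2
    split_ifs at * <;> omega
  intro a ha b hb hab h
  rcases (cycleGraph_adj_iff hm a b).1 h with rfl | rfl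
  · exact key b hb ha
  · exact key a ha hb

theorem exists_mem_lsPlus_puncturedWheel {m : ℕ} (hm : 2 ≤ m) :
    ∃ x ∈ lsPlus (edgeRelaxation (puncturedWheel m)),
      (m : ℝ) < ∑ j, x (some j) + (m - 1) * x none := by
  classical
  have hm1 : 1 ≤ m := by omega
  have hmR : (2 : ℝ) ≤ m := by exact_mod_cast hm
  have hv1 : (1 : Fin (2 * m + 1)).val = 1 := by
    rw [Fin.val_one', Nat.mod_eq_of_lt (by omega)]
  let F : Option (Fin (2 * m + 1)) → Finset (Option (Fin (2 * m + 1))) := fun o =>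
    o.elim {none, some 0} fun e => (cycleStable m e).map Function.Embedding.some
  have hsum : ∀ (e : Fin (2 * m + 1)) (x : Option (Fin (2 * m + 1)) → ℝ),
      ∑ v ∈ F (some e), x v = ∑ j ∈ cycleStable m e, x (some j) := fun e x => by
    simp [F]
  have hmem : ∀ e j : Fin (2 * m + 1), some j ∈ F (some e) ↔
      (j - e).val % 2 = 0 ∧ (j - e).val ≠ 0 := fun e j => by
    simp [F, cycleStable]
  suffices h : ∃ x ∈ lsPlus (edgeRelaxation (puncturedWheel m)),
      (m : ℝ) < ∑ v, (Option.elim v ((m : ℝ) - 1) fun _ => 1) * x v by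
    obtain ⟨x, hx, h⟩ := h
    refine ⟨x, hx, ?_⟩
    rw [Fintype.sum_option] at h
    simp only [Option.elim, one_mul] at h
    linarith
  refine exists_mem_lsPlus_of_tight_hub (F := F) (h := none) (w := some 0) (by linarith) rfl ?_ ?_
    ?_ rfl ?_ ⟨some 1, by simp, ?_⟩ ?_ ?_
  · rintro (_ | e)
    · intro a ha b hb hab h
      simp only [F, Option.elim, Finset.coe_insert, Finset.coe_singleton, Set.mem_insert_iff,
        Set.mem_singleton_iff] at ha hb
      rcases ha with rfl | rfl <;> rcases hb with rfl | rfl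
      · exact hab rfl
      · exact h rfl
      · exact h rfl
      · exact hab rfl
    · intro a ha b hb hab h
      simp only [F, Option.elim, Finset.coe_map, Set.mem_image, Finset.mem_coe] at ha hb
      obtain ⟨a, ha, rfl⟩ := ha
      obtain ⟨b, hb, rfl⟩ := hb
      exact isIndepSet_cycleStable hm1 e ha hb (fun e => hab (by rw [e])) h
  · rintro (_ | e)
    · simp only [F, Option.elim]
      rw [Finset.sum_pair (by simp)]
      ring
    · rw [hsum]
      simp [card_cycleStable]
  · intro t x hx
    have h1 : ∀ e : Fin (2 * m + 1), x (some (e + 1)) = x (some e) := by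
      intro e
      have := sum_cycleStable_sub hm1 (e - 1) fun j => x (some j)
      rw [sub_add_cancel] at this
      have h2 := hx (e - 1)
      have h3 := hx (e + 1)
      rw [hsum] at h2 h3
      linarith
    have h2 := fin_constant_of_add_one (f := fun e => x (some e)) h1
    have h3 := hx 0
    rw [hsum, Finset.sum_congr rfl fun j _ => h2 j, Finset.sum_const, card_cycleStable,
      nsmul_eq_mul] at h3
    field_simp
    linarith
  · intro e; simp [F]
  · simp [Fin.ext_iff]
    omega
  · rintro (_ | c) hc hc0
    · exact absurd rfl hc
    have hc1 : c.val ≠ 0 := fun h => hc0 (congrArg some (Fin.ext h))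
    have hc2 := c.2
    simp only [hmem]
    -- The stable sets `{0, 3, 5, …, 2m-1}` and `{0, 2, 4, …, 2m-2}` contain `0` and avoid all
    -- nonzero even nodes, respectively all odd nodes.
    by_cases hp : c.val % 2 = 0
    · refine ⟨1, ?_⟩
      simp only [fin_val_sub_eq_ite, hv1, Fin.val_zero]
      split_ifs <;> omega
    · obtain ⟨e, he⟩ : ∃ e : Fin (2 * m + 1), e.val = 2 * m - 1 := ⟨⟨2 * m - 1, by omega⟩, rfl⟩
      have h : ((0 : Fin (2 * m + 1)) - e).val = 2 := by
        rw [fin_val_sub_eq_ite, if_neg (by rw [Fin.val_zero]; omega), Fin.val_zero]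
        omega
      refine ⟨e, ?_⟩
      rw [h, fin_val_sub_eq_ite]
      split_ifs <;> omega
  · rintro (_ | a) (_ | b) ha ha0 hb hb0
    · exact absurd rfl ha
    · exact absurd rfl ha
    · exact absurd rfl hb
    have := a.2
    have := b.2
    simp only [hmem]
    -- `cycleStable m e` consists of the nodes at positive even distance after `e`; starting at `a`
    -- or at `b`, according to parity, excludes both.
    by_cases hp : (b - a).val % 2 = 0
    · refine ⟨b, ?_⟩
      simp only [fin_val_sub_eq_ite] at *
      split_ifs at * <;> omega
    · refine ⟨a, ?_⟩
      simp only [fin_val_sub_eq_ite] at *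
      split_ifs at * <;> omega

/-! ### The walk along a marked cycle. -/

/-- Reading the marks `b 1, b 2, …` along a cycle: the second component alternates along unmarked
positions and is `true` at marked ones; the first one counts the marked positions that follow a
position with value `true`. -/
def walk (b : ℕ → Prop) [DecidablePred b] : ℕ → ℕ × Bool
  | 0 => (0, true)
  | m + 1 =>
    if b (m + 1) then (if (walk b m).2 then ((walk b m).1 + 1, true) else ((walk b m).1, true))
    else ((walk b m).1, !(walk b m).2)

section walk

variable {b : ℕ → Prop} [DecidablePred b]

lemma walk_succ_of_not {m : ℕ} (h : ¬ b (m + 1)) :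
    walk b (m + 1) = ((walk b m).1, !(walk b m).2) := by
  rw [walk, if_neg h]

lemma walk_succ_of_true {m : ℕ} (h : b (m + 1)) (h' : (walk b m).2 = true) :
    walk b (m + 1) = ((walk b m).1 + 1, true) := by
  rw [walk, if_pos h, if_pos h']

lemma walk_succ_of_false {m : ℕ} (h : b (m + 1)) (h' : (walk b m).2 = false) :
    walk b (m + 1) = ((walk b m).1, true) := by
  rw [walk, if_pos h, h']; rfl

lemma walk_succ_cases (m : ℕ) :
    (walk b (m + 1) = ((walk b m).1, !(walk b m).2)) ∨
      (b (m + 1) ∧ (walk b m).2 = true ∧ walk b (m + 1) = ((walk b m).1 + 1, true)) := by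
  by_cases h : b (m + 1)
  · cases h' : (walk b m).2
    · left; rw [walk_succ_of_false h h']; rfl
    · exact Or.inr ⟨h, rfl, walk_succ_of_true h h'⟩
  · left; rw [walk_succ_of_not h]

lemma walk_snd_of_mark {m : ℕ} (h : b m ∨ m = 0) : (walk b m).2 = true := by
  rcases m with _ | m
  · rfl
  · have h : b (m + 1) := by simpa using h
    cases h' : (walk b m).2
    · rw [walk_succ_of_false h h']
    · rw [walk_succ_of_true h h']

/-- Every step either negates the value or raises the count by one. At the end this makes the count
even, so that the image of the rim is again an odd cycle. -/
lemma walk_parity (m : ℕ) :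
    (m + (walk b m).1 + if (walk b m).2 then 0 else 1) % 2 = 0 := by
  induction m with
  | zero => rfl
  | succ m ih =>
    rcases walk_succ_cases (b := b) m with h | ⟨-, h1, h⟩
    · rw [h]
      cases h' : (walk b m).2 <;> simp [h'] at ih ⊢ <;> omega
    · rw [h]
      rw [h1] at ih
      simp only [if_true] at ih ⊢
      omega

lemma walk_fst_mono : Monotone fun m => (walk b m).1 := by
  refine monotone_nat_of_le_succ fun m => ?_
  rcases walk_succ_cases (b := b) m with h | ⟨-, -, h⟩ <;> simp [h]

lemma walk_add {r d : ℕ} (hr : (walk b r).2 = true) (h : ∀ j, r < j → j ≤ r + d → ¬ b j) :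
    walk b (r + d) = ((walk b r).1, decide (d % 2 = 0)) := by
  induction d with
  | zero => ext <;> simp [hr]
  | succ d ih =>
    rw [← add_assoc, walk_succ_of_not (h _ (by omega) (by omega)),
      ih fun j hj hj' => h j hj (by omega)]
    ext
    · rfl
    · simp only [← decide_not, decide_eq_decide]; omega

lemma walk_fst_of_odd {r q : ℕ} (hr : (walk b r).2 = true) (hq : b q) (hrq : r < q)
    (hodd : (q - r) % 2 = 1) (h : ∀ j, r < j → j < q → ¬ b j) :
    (walk b q).1 = (walk b r).1 + 1 := by
  obtain ⟨d, rfl⟩ : ∃ d, q = r + d + 1 := ⟨q - r - 1, by omega⟩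
  have h1 := walk_add (d := d) hr fun j hj hj' => h j hj (by omega)
  have h2 : (walk b (r + d)).2 = true := by rw [h1]; simp only [decide_eq_true_eq]; omega
  rw [walk_succ_of_true hq h2, h1]

lemma exists_last_mark (b : ℕ → Prop) (m : ℕ) :
    ∃ r ≤ m, (b r ∨ r = 0) ∧ ∀ j, r < j → j ≤ m → ¬ b j := by
  induction m with
  | zero => exact ⟨0, le_rfl, Or.inr rfl, fun j hj hj' => by omega⟩
  | succ m ih =>
    by_cases h : b (m + 1)
    · exact ⟨m + 1, le_rfl, Or.inl h, fun j hj hj' => by omega⟩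
    · obtain ⟨r, hr, hr', hr''⟩ := ih
      refine ⟨r, by omega, hr', fun j hj hj' => ?_⟩
      rcases hj'.eq_or_lt with rfl | h'
      · exact h
      · exact hr'' j hj (by omega)

lemma exists_odd_gap_of_walk {m : ℕ} (h : (walk b m).2 = true) :
    ∃ r ≤ m, (b r ∨ r = 0) ∧ (∀ j, r < j → j ≤ m → ¬ b j) ∧ (m + 1 - r) % 2 = 1 := by
  obtain ⟨r, hr, hr', hr''⟩ := exists_last_mark b m
  obtain ⟨d, rfl⟩ := Nat.exists_eq_add_of_le hr
  refine ⟨r, hr, hr', hr'', ?_⟩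
  rw [walk_add (walk_snd_of_mark hr') hr''] at h
  simp only [decide_eq_true_eq] at h
  omega

/-- The sum of the values of the literals along a walk. -/
lemma sum_walk (X : ℕ → ℝ) (m : ℕ) :
    ∑ i ∈ Finset.range (m + 1), (if (walk b i).2 then X (walk b i).1 else 1 - X (walk b i).1) =
      ∑ j ∈ Finset.range ((walk b m).1 + 1), X j +
        if (walk b m).2 then ((m : ℝ) - (walk b m).1) / 2
        else 1 - X (walk b m).1 + ((m : ℝ) - 1 - (walk b m).1) / 2 := by
  induction m with
  | zero => simp [walk]
  | succ m ih =>
    rw [Finset.sum_range_succ, ih]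
    -- A literal followed by its complement contributes exactly 1, and a new variable enters only
    -- when the count rises.
    rcases walk_succ_cases (b := b) m with h | ⟨-, h1, h⟩
    · rw [h]
      cases h' : (walk b m).2 <;> simp <;> ring
    · rw [h, h1]
      simp only [if_true]
      rw [Finset.sum_range_succ _ ((walk b m).1 + 1)]
      push_cast
      ring

/-- The bound of one per two consecutive positions loses a half at every counted mark, where `e`
vanishes. The last term records an unfinished pair. The bound `K` serves to leave out the final
position `2k`, which is marked even when it is not a neighbour of `0`. -/
lemma sum_le_walk {e : ℕ → ℝ} {K : ℕ} (h1 : ∀ m, e m ≤ 1) (hadj : ∀ m, e m + e (m + 1) ≤ 1)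
    (hb : ∀ m, 1 ≤ m → m < K → b m → e m = 0) {m : ℕ} (hm : m < K) :
    2 * ∑ i ∈ Finset.range (m + 1), e i + (walk b m).1 ≤
      m + 2 * e 0 + if (walk b m).2 then 0 else 2 * e m - 1 := by
  induction m with
  | zero => simp [walk]
  | succ m ih =>
    have ih := ih (by omega)
    rw [Finset.sum_range_succ]
    by_cases h : b (m + 1)
    · rw [hb _ (by omega) hm h]
      cases h' : (walk b m).2
      · rw [walk_succ_of_false h h']
        simp only [h', if_true, Bool.false_eq_true, if_false] at ih ⊢
        push_cast
        linarith [h1 m]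
      · rw [walk_succ_of_true h h']
        simp only [h', if_true] at ih ⊢
        push_cast
        linarith
    · rw [walk_succ_of_not h]
      cases h' : (walk b m).2
      · simp only [h', if_true, Bool.false_eq_true, if_false, Bool.not_false] at ih ⊢
        push_cast
        linarith [hadj m]
      · simp only [h', if_true, Bool.false_eq_true, if_false, Bool.not_true] at ih ⊢
        push_cast
        linarith

end walk

/-! ### Rim positions and the reduction to the punctured wheel. -/

/-- The node at position `p` of the cycle `1, …, 2k+1`, for positions modulo `2k+1`. -/
def rimNode (k p : ℕ) : Fin (2 * k + 2) :=
  Fin.succ ⟨p % (2 * k + 1), Nat.mod_lt _ (by omega)⟩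

lemma rimNode_ne_zero (k p : ℕ) : rimNode k p ≠ 0 := Fin.succ_ne_zero _

lemma rimNode_val (k p : ℕ) : (rimNode k p).val = p % (2 * k + 1) + 1 := rfl

lemma rimNode_eq_iff {k p q : ℕ} : rimNode k p = rimNode k q ↔ p ≡ q [MOD 2 * k + 1] := by
  rw [Fin.ext_iff, rimNode_val, rimNode_val, Nat.ModEq]
  omega

lemma rimNode_add_congr {k p q : ℕ} (h : rimNode k p = rimNode k q) (j : ℕ) :
    rimNode k (p + j) = rimNode k (q + j) := by
  rw [rimNode_eq_iff] at *
  exact h.add_right j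

lemma rimNode_add_inj {k s m m' : ℕ} (hm : m < 2 * k + 1) (hm' : m' < 2 * k + 1)
    (h : rimNode k (s + m) = rimNode k (s + m')) : m = m' := by
  rw [rimNode_eq_iff] at h
  exact (Nat.ModEq.add_left_cancel' s h).eq_of_lt_of_lt hm hm'

lemma rimNode_add_period (k p : ℕ) : rimNode k (p + (2 * k + 1)) = rimNode k p := by
  rw [rimNode_eq_iff]
  exact Nat.add_mod_right _ _

/-- The position, relative to `s`, of a node of the cycle. -/
def rimIndex (k s : ℕ) (v : Fin (2 * k + 2)) : ℕ :=
  (v.val - 1 + (2 * k + 1) - s % (2 * k + 1)) % (2 * k + 1)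

lemma rimIndex_lt (k s : ℕ) (v : Fin (2 * k + 2)) : rimIndex k s v < 2 * k + 1 :=
  Nat.mod_lt _ (by omega)

lemma rimNode_rimIndex {k s : ℕ} {v : Fin (2 * k + 2)} (hv : v ≠ 0) :
    rimNode k (s + rimIndex k s v) = v := by
  have h0 : v.val ≠ 0 := fun h => hv (Fin.ext h)
  have h1 := v.2
  have hs := Nat.mod_lt s (show 0 < 2 * k + 1 by omega)
  rw [Fin.ext_iff, rimNode_val, rimIndex, Nat.add_mod_mod]
  have : s + (v.val - 1 + (2 * k + 1) - s % (2 * k + 1)) ≡ v.val - 1 [MOD 2 * k + 1] := by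
    have h2 := Nat.div_add_mod s (2 * k + 1)
    have h3 : s + (v.val - 1 + (2 * k + 1) - s % (2 * k + 1)) =
        v.val - 1 + (2 * k + 1) * (s / (2 * k + 1) + 1) := by
      rw [mul_add]
      omega
    rw [h3]
    exact Nat.add_mul_mod_self_left _ _ _
  rw [this, Nat.mod_eq_of_lt (by omega)]
  omega

lemma rimIndex_rimNode {k s m : ℕ} (hm : m < 2 * k + 1) :
    rimIndex k s (rimNode k (s + m)) = m :=
  rimNode_add_inj (rimIndex_lt _ _ _) hm (rimNode_rimIndex (rimNode_ne_zero _ _))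

lemma sum_range_rimNode (k s : ℕ) (f : Fin (2 * k + 2) → ℝ) :
    ∑ m ∈ Finset.range (2 * k + 1), f (rimNode k (s + m)) = ∑ i : Fin (2 * k + 1), f i.succ := by
  induction s with
  | zero =>
    rw [← Fin.sum_univ_eq_sum_range]
    refine Finset.sum_congr rfl fun i _ => ?_
    congr 1
    rw [Fin.ext_iff, rimNode_val, zero_add, Nat.mod_eq_of_lt i.2, Fin.val_succ]
  | succ s ih =>
    rw [← ih, Finset.sum_range_succ, Finset.sum_range_succ']
    congr 1
    · exact Finset.sum_congr rfl fun m _ => by congr 2; ring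
    · rw [add_zero, show s + 1 + 2 * k = s + (2 * k + 1) by ring, rimNode_add_period]

lemma adj_rimNode_iff {k : ℕ} (hk : 2 ≤ k) {G : SimpleGraph (Fin (2 * k + 2))}
    (hG : deleteZero G = cycleGraph (2 * k + 1)) {s m m' : ℕ} (hm : m < 2 * k + 1)
    (hm' : m' < 2 * k + 1) : G.Adj (rimNode k (s + m)) (rimNode k (s + m')) ↔
      (m = m' + 1 ∨ (m = 0 ∧ m' = 2 * k)) ∨ (m' = m + 1 ∨ (m' = 0 ∧ m = 2 * k)) := by
  have hadj : ∀ a b : Fin (2 * k + 1), G.Adj a.succ b.succ ↔ a = b + 1 ∨ b = a + 1 := fun a b => by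
    rw [← cycleGraph_adj_iff (by omega), ← hG]; rfl
  have key : ∀ m m', m < 2 * k + 1 → m' < 2 * k + 1 →
      ((⟨(s + m) % (2 * k + 1), Nat.mod_lt _ (by omega)⟩ : Fin (2 * k + 1)) =
        ⟨(s + m') % (2 * k + 1), Nat.mod_lt _ (by omega)⟩ + 1 ↔
          (m = m' + 1 ∨ (m = 0 ∧ m' = 2 * k))) := by
    intro m m' hm hm'
    have h1 : ((⟨(s + m') % (2 * k + 1), Nat.mod_lt _ (by omega)⟩ : Fin (2 * k + 1)) + 1).val =
        (s + (m' + 1)) % (2 * k + 1) := by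
      rw [fin_val_add_one_eq_ite (by omega), ← add_assoc, Nat.add_mod (s + m') 1,
        Nat.mod_eq_of_lt (show 1 < 2 * k + 1 by omega)]
      have := Nat.mod_lt (s + m') (show 0 < 2 * k + 1 by omega)
      dsimp only
      split_ifs with h
      · rw [h, Nat.mod_self]
      · exact (Nat.mod_eq_of_lt (by omega)).symm
    rw [Fin.ext_iff, h1]
    change s + m ≡ s + (m' + 1) [MOD 2 * k + 1] ↔ _
    rw [Nat.ModEq.add_iff_left rfl]
    by_cases h : m' = 2 * k
    · subst h
      rw [Nat.ModEq, Nat.mod_self, Nat.mod_eq_of_lt hm]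
      omega
    · rw [Nat.ModEq, Nat.mod_eq_of_lt hm, Nat.mod_eq_of_lt (by omega)]
      omega
  rw [rimNode, rimNode, hadj, key m m' hm hm', key m' m hm' hm]

/-- If the walk along the cycle from `s` never meets a neighbour of `0` with value `true`, then the
deletion of the node at `s` leaves a bipartite graph. -/
theorem isLSPlusPerfect_of_walk {k : ℕ} (hk : 2 ≤ k) {G : SimpleGraph (Fin (2 * k + 2))}
    (hG : deleteZero G = cycleGraph (2 * k + 1)) {s : ℕ} {b : ℕ → Prop} [DecidablePred b]
    (hb : ∀ m, b m ↔ G.Adj 0 (rimNode k (s + m)))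
    (h : ∀ m, m + 1 ≤ 2 * k → b (m + 1) → (walk b m).2 = false) : IsLSPlusPerfect G := by
  let c : Fin (2 * k + 2) → Bool := fun v => if v = 0 then false else (walk b (rimIndex k s v)).2
  have hc : ∀ m, m < 2 * k + 1 → c (rimNode k (s + m)) = (walk b m).2 := fun m hm => by
    simp only [c, rimNode_ne_zero, if_false, rimIndex_rimNode hm]
  have hc0 : c 0 = false := rfl
  -- Without counted marks the value alternates along the whole path, and neighbours of `0` always
  -- carry `true`; giving `0` the value `false` completes a proper colouring.
  have hflip : ∀ m, m + 1 ≤ 2 * k → (walk b (m + 1)).2 = !(walk b m).2 := by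
    intro m hm
    rcases walk_succ_cases (b := b) m with h1 | ⟨h1, h2, -⟩
    · rw [h1]
    · rw [h m hm h1] at h2
      exact absurd h2 (by simp)
  have hrim : ∀ v, v ≠ 0 → v ≠ rimNode k s → ∃ m, 1 ≤ m ∧ m < 2 * k + 1 ∧ v = rimNode k (s + m) := by
    intro v hv hvs
    refine ⟨rimIndex k s v, ?_, rimIndex_lt _ _ _, (rimNode_rimIndex hv).symm⟩
    by_contra h0
    have h1 := rimNode_rimIndex (s := s) hv
    rw [show rimIndex k s v = 0 by omega, add_zero] at h1
    exact hvs h1.symm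
  have hspoke : ∀ m, m < 2 * k + 1 → G.Adj 0 (rimNode k (s + m)) →
      c (rimNode k (s + m)) = true := fun m hm hadj => by
    rw [hc m hm, walk_snd_of_mark (Or.inl ((hb m).2 hadj))]
  refine isLSPlusPerfect_of_bipartite_delete (rimNode k s) c fun u w hu hw huw => ?_
  by_cases hu0 : u = 0
  · subst hu0
    obtain ⟨m, hm1, hm, rfl⟩ := hrim w huw.ne' hw
    rw [hc0, hspoke m hm huw]
    simp
  by_cases hw0 : w = 0
  · subst hw0
    obtain ⟨m, hm1, hm, rfl⟩ := hrim u hu0 hu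
    rw [hc0, hspoke m hm huw.symm]
    simp
  obtain ⟨m, hm1, hm, rfl⟩ := hrim u hu0 hu
  obtain ⟨m', hm1', hm', rfl⟩ := hrim w hw0 hw
  rw [hc m hm, hc m' hm']
  rw [adj_rimNode_iff hk hG hm hm'] at huw
  rcases huw with (h1 | h1) | (h1 | h1)
  · rw [h1, hflip m' (by omega)]; simp
  · omega
  · rw [h1, hflip m (by omega)]; simp
  · omega

/-- Without the hub, this is the bound `k` for stable sets of an odd cycle. With the hub, the
neighbours of `0` are excluded and `sum_le_walk` saves half of the count, up to the last position,
which is handled by its adjacency to position 0. -/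
lemma sum_mul_indicator_rim_le {k : ℕ} (hk : 2 ≤ k) {G : SimpleGraph (Fin (2 * k + 2))}
    (hG : deleteZero G = cycleGraph (2 * k + 1)) {s : ℕ} {b : ℕ → Prop} [DecidablePred b]
    (hb : ∀ m, b m ↔ (G.Adj 0 (rimNode k (s + m)) ∨ m = 2 * k))
    {S : Set (Fin (2 * k + 2))} (hS : G.IsIndepSet S) :
    ∑ v, (Fin.cases (((walk b (2 * k)).1 : ℝ) / 2 - 1) (fun _ => 1) v : ℝ) * S.indicator 1 v ≤ k := by
  classical
  set N := (walk b (2 * k)).1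
  let e : ℕ → ℝ := fun m => S.indicator 1 (rimNode k (s + m))
  have he : ∀ m, e m = 0 ∨ e m = 1 := fun m => by
    by_cases h : rimNode k (s + m) ∈ S <;> simp [e, h]
  have he1 : ∀ m, e m ≤ 1 := fun m => by rcases he m with h | h <;> rw [h] <;> norm_num
  have hpair : ∀ u v, G.Adj u v → (S.indicator 1 u + S.indicator 1 v : ℝ) ≤ 1 := by
    intro u v huv
    by_cases hu : u ∈ S <;> by_cases hv : v ∈ S <;> simp [hu, hv]
    exact (hS hu hv huv.ne huv).elim
  have hadj : ∀ m, e m + e (m + 1) ≤ 1 := fun m => by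
    refine hpair _ _ ?_
    have := (adj_rimNode_iff hk hG (s := s + m) (m := 0) (m' := 1) (by omega) (by omega)).2 (by simp)
    exact this
  have hwrap : e (2 * k) + e 0 ≤ 1 :=
    hpair _ _ ((adj_rimNode_iff hk hG (by omega) (by omega)).2 (by omega))
  rw [Fin.sum_univ_succ]
  simp only [Fin.cases_zero, Fin.cases_succ, one_mul]
  rw [← sum_range_rimNode k s fun v => S.indicator 1 v]
  change _ + ∑ m ∈ Finset.range (2 * k + 1), e m ≤ _
  by_cases h0 : (0 : Fin (2 * k + 2)) ∈ S
  · have hb0 : ∀ m, 1 ≤ m → m < 2 * k → b m → e m = 0 := by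
      intro m _ hm hbm
      have h1 : G.Adj 0 (rimNode k (s + m)) := by
        rcases (hb m).1 hbm with h | h
        · exact h
        · omega
      have := hpair _ _ h1
      rcases he m with h | h
      · exact h
      · simp only [e] at h
        rw [h] at this
        simp [h0] at this
        exact absurd this (by norm_num)
    have h1 := sum_le_walk he1 hadj hb0 (m := 2 * k - 1) (by omega)
    have h2 := he1 (2 * k - 1)
    have h3 : b (2 * k - 1 + 1) := (hb _).2 (Or.inr (by omega))
    have h4 : (((2 * k - 1 : ℕ) : ℝ)) = 2 * k - 1 := by
      rw [Nat.cast_sub (by omega)]; push_cast; ring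
    have h5 : 2 * k - 1 + 1 = 2 * k := by omega
    rw [h4, h5] at h1
    rw [Finset.sum_range_succ]
    simp only [Set.indicator_of_mem h0, Pi.one_apply, mul_one]
    cases h' : (walk b (2 * k - 1)).2
    · have h6 := walk_succ_of_false h3 h'
      rw [h5] at h6
      rw [h'] at h1
      simp only [N, h6, Bool.false_eq_true, if_false] at h1 ⊢
      linarith
    · have h6 := walk_succ_of_true h3 h'
      rw [h5] at h6
      rw [h'] at h1
      simp only [N, h6, if_true] at h1 ⊢
      push_cast
      linarith
  · simp only [Set.indicator_of_notMem h0, mul_zero, zero_add]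
    have h1 : ∀ m, 2 * ∑ i ∈ Finset.range (m + 1), e i ≤ m + e 0 + e m := by
      intro m
      induction m with
      | zero => simp; linarith
      | succ m ih =>
        rw [Finset.sum_range_succ]
        push_cast
        linarith [hadj m]
    have h2 := h1 (2 * k)
    push_cast at h2
    have h3 : ∃ z : ℕ, ∑ m ∈ Finset.range (2 * k + 1), e m = z := by
      refine ⟨∑ m ∈ Finset.range (2 * k + 1), if rimNode k (s + m) ∈ S then 1 else 0, ?_⟩
      push_cast
      exact Finset.sum_congr rfl fun m _ => by simp [e, Set.indicator_apply]
    obtain ⟨z, hz⟩ := h3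
    rw [hz] at h2 ⊢
    have h4 : 2 * z ≤ 2 * k + 1 := by
      have : (2 : ℝ) * z ≤ 2 * k + 1 := by linarith
      exact_mod_cast this
    exact_mod_cast (by omega : z ≤ k)

/-- The nonneighbour at position 0 becomes the punctured wheel's rim node 0, which lacks a spoke. As
position 1 is marked, later positions have count at least 1, so neighbours of `0` become rim nodes
with spokes; the mark at `2k` makes the last literal positive and closes the cycle. -/
theorem not_isLSPlusPerfect_of_walk {k : ℕ} (hk : 2 ≤ k) {G : SimpleGraph (Fin (2 * k + 2))}
    (hG : deleteZero G = cycleGraph (2 * k + 1)) {s : ℕ} {b : ℕ → Prop} [DecidablePred b]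
    (hb : ∀ m, b m ↔ (G.Adj 0 (rimNode k (s + m)) ∨ m = 2 * k))
    (h0 : ¬ G.Adj 0 (rimNode k s)) (h1 : b 1) (hN : 3 ≤ (walk b (2 * k)).1) :
    ¬ IsLSPlusPerfect G := by
  have hlast : (walk b (2 * k)).2 = true := walk_snd_of_mark (Or.inl ((hb _).2 (Or.inr rfl)))
  obtain ⟨M, hM⟩ : ∃ M, (walk b (2 * k)).1 = 2 * M := by
    have := walk_parity (b := b) (2 * k)
    rw [hlast] at this
    simp only [if_true] at this
    exact ⟨(walk b (2 * k)).1 / 2, by omega⟩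
  have hcount1 : (walk b 1).1 = 1 := by
    rw [walk_succ_of_true h1 rfl]
    rfl
  have hcount : ∀ m, 1 ≤ m → 1 ≤ (walk b m).1 := fun m hm => by
    rw [← hcount1]
    exact walk_fst_mono hm
  have hle : ∀ m, m < 2 * k + 1 → (walk b m).1 < 2 * M + 1 := fun m hm => by
    have : (walk b m).1 ≤ (walk b (2 * k)).1 := walk_fst_mono (by omega : m ≤ 2 * k)
    omega
  let lit : ℕ → Option (Fin (2 * M + 1)) × Bool := fun m =>
    (some ⟨(walk b m).1 % (2 * M + 1), Nat.mod_lt _ (by omega)⟩, (walk b m).2)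
  let φ : Fin (2 * k + 2) → Option (Fin (2 * M + 1)) × Bool := fun v =>
    if v = 0 then (none, true) else lit (rimIndex k s v)
  have hφ0 : φ 0 = (none, true) := rfl
  have hφ : ∀ m, m < 2 * k + 1 → φ (rimNode k (s + m)) = lit m := fun m hm => by
    simp only [φ, rimNode_ne_zero, if_false, rimIndex_rimNode hm]
  let R : Option (Fin (2 * M + 1)) × Bool → Option (Fin (2 * M + 1)) × Bool → Prop := fun p q =>
    (p.1 = q.1 ∧ p.2 ≠ q.2) ∨ (p.2 = true ∧ q.2 = true ∧ (puncturedWheel M).Adj p.1 q.1)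
  have hRsymm : ∀ p q, R p q → R q p := by
    rintro p q (⟨h, h'⟩ | ⟨h, h', h''⟩)
    · exact Or.inl ⟨h.symm, h'.symm⟩
    · exact Or.inr ⟨h', h, h''.symm⟩
  have hspoke : ∀ m, m < 2 * k + 1 → G.Adj 0 (rimNode k (s + m)) → R (φ 0) (φ (rimNode k (s + m))) := by
    intro m hm hadj
    have hm1 : 1 ≤ m := by
      by_contra hm1
      rw [show m = 0 by omega] at hadj
      exact h0 hadj
    rw [hφ0, hφ m hm]
    refine Or.inr ⟨rfl, walk_snd_of_mark (Or.inl ((hb m).2 (Or.inl hadj))), ?_⟩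
    change (⟨(walk b m).1 % (2 * M + 1), _⟩ : Fin (2 * M + 1)) ≠ 0
    rw [ne_eq, Fin.ext_iff]
    simp only [Fin.val_zero, Nat.mod_eq_of_lt (hle m hm)]
    have := hcount m hm1
    omega
  have hstep : ∀ m, m + 1 < 2 * k + 1 → R (lit m) (lit (m + 1)) := by
    intro m hm
    rcases walk_succ_cases (b := b) m with h | ⟨-, h', h⟩
    · left
      simp only [lit, h]
      simp
    · right
      simp only [lit, h, h', true_and]
      change (cycleGraph (2 * M + 1)).Adj _ _
      rw [cycleGraph_adj_iff (by omega)]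
      right
      have h2 := hle (m + 1) hm
      rw [h] at h2
      simp only at h2
      rw [Fin.ext_iff, fin_val_add_one_eq_ite (by omega)]
      simp only [Nat.mod_eq_of_lt h2, Nat.mod_eq_of_lt (hle m (by omega))]
      split_ifs <;> omega
  have hwrap : R (lit (2 * k)) (lit 0) := by
    right
    simp only [lit, hlast, hM]
    refine ⟨trivial, rfl, ?_⟩
    change (cycleGraph (2 * M + 1)).Adj _ _
    rw [cycleGraph_adj_iff (by omega)]
    right
    rw [Fin.ext_iff, fin_val_add_one_eq_ite (by omega)]
    simp [walk, Nat.mod_eq_of_lt (show 2 * M < 2 * M + 1 by omega)]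
  obtain ⟨x', hx', hviol⟩ := exists_mem_lsPlus_puncturedWheel (m := M) (by omega)
  have hx := literal_mem_lsPlus (G := G) φ (fun u v huv => ?_) hx'
  · intro hp
    rw [hp] at hx
    have hle := sum_mul_le_of_mem_stablePolytope
      (fun S hS => sum_mul_indicator_rim_le hk hG hb hS) hx
    rw [Fin.sum_univ_succ] at hle
    simp only [Fin.cases_zero, Fin.cases_succ, one_mul] at hle
    rw [← sum_range_rimNode k s fun v => if (φ v).2 then x' (φ v).1 else 1 - x' (φ v).1] at hle
    let X : ℕ → ℝ := fun j => x' (some ⟨j % (2 * M + 1), Nat.mod_lt _ (by omega)⟩)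
    have h2 := sum_walk (b := b) X (2 * k)
    have h3 : ∀ m ∈ Finset.range (2 * k + 1),
        (if (φ (rimNode k (s + m))).2 then x' (φ (rimNode k (s + m))).1
          else 1 - x' (φ (rimNode k (s + m))).1) =
        if (walk b m).2 then X (walk b m).1 else 1 - X (walk b m).1 := fun m hm => by
      rw [hφ m (Finset.mem_range.1 hm)]
    have h4 : ∑ j ∈ Finset.range (2 * M + 1), X j = ∑ j, x' (some j) := by
      rw [← Fin.sum_univ_eq_sum_range]
      refine Finset.sum_congr rfl fun j _ => ?_
      simp only [X, Nat.mod_eq_of_lt j.2]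
    rw [Finset.sum_congr rfl h3, h2, hlast, hM, h4, hφ0] at hle
    simp only [if_true] at hle
    push_cast at hle
    -- The literals on the rim sum to `∑ X + k - M`, so the violation for the punctured wheel
    -- becomes one for `G`.
    linarith
  · change R (φ u) (φ v)
    by_cases hu : u = 0
    · subst hu
      have := hspoke _ (rimIndex_lt k s v)
      rw [rimNode_rimIndex huv.ne'] at this
      exact this huv
    by_cases hv : v = 0
    · subst hv
      have := hspoke _ (rimIndex_lt k s u)
      rw [rimNode_rimIndex hu] at this
      exact hRsymm _ _ (this huv.symm)
    obtain ⟨m, hm, rfl⟩ : ∃ m, m < 2 * k + 1 ∧ u = rimNode k (s + m) :=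
      ⟨_, rimIndex_lt k s u, (rimNode_rimIndex hu).symm⟩
    obtain ⟨m', hm', rfl⟩ : ∃ m, m < 2 * k + 1 ∧ v = rimNode k (s + m) :=
      ⟨_, rimIndex_lt k s v, (rimNode_rimIndex hv).symm⟩
    rw [hφ m hm, hφ m' hm']
    rw [adj_rimNode_iff hk hG hm hm'] at huv
    rcases huv with (rfl | ⟨rfl, rfl⟩) | (rfl | ⟨rfl, rfl⟩)
    · exact hRsymm _ _ (hstep m' (by omega))
    · exact hRsymm _ _ hwrap
    · exact hstep m (by omega)
    · exact hwrap

/-! ### Odd arcs and odd central cycles. -/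

/-- The arc of length `d` of the cycle starting at position `p` is odd and runs from a neighbour of
`0` to the next one. -/
def IsOddArc {k : ℕ} (G : SimpleGraph (Fin (2 * k + 2))) (p d : ℕ) : Prop :=
  d < 2 * k + 1 ∧ d % 2 = 1 ∧ G.Adj 0 (rimNode k p) ∧ G.Adj 0 (rimNode k (p + d)) ∧
    ∀ j, 0 < j → j < d → ¬ G.Adj 0 (rimNode k (p + j))

/-- The nodes of the central cycle through the arc of length `d` starting at position `p`. -/
def arcNodes (k p d : ℕ) : Set (Fin (2 * k + 2)) :=
  {v | v = 0 ∨ ∃ j ≤ d, v = rimNode k (p + j)}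

lemma ncard_arcNodes {k p d : ℕ} (hd : d < 2 * k + 1) : (arcNodes k p d).ncard = d + 2 := by
  classical
  have h : arcNodes k p d =
      ↑(insert 0 ((Finset.range (d + 1)).image fun j => rimNode k (p + j))) := by
    ext v
    simp only [arcNodes, Set.mem_ofPred_eq, Finset.coe_insert, Finset.coe_image,
      Set.mem_insert_iff, Set.mem_image, Finset.mem_coe, Finset.mem_range, Nat.lt_succ_iff]
    simp only [eq_comm]
  rw [h, Set.ncard_coe_finset, Finset.card_insert_of_notMem, Finset.card_image_of_injOn,
    Finset.card_range]
  · intro i hi j hj hij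
    simp only [Finset.coe_range, Set.mem_Iio] at hi hj
    exact rimNode_add_inj (by omega) (by omega) hij
  · simp only [Finset.mem_image, not_exists, not_and]
    exact fun j _ => rimNode_ne_zero _ _

lemma insideArc_rimNode_iff {k p d : ℕ} (hd0 : 0 < d) (hd : d < 2 * k + 1)
    (w : Fin (2 * k + 2)) : InsideArc (rimNode k p) (rimNode k (p + d)) w ↔
      ∃ j, 0 < j ∧ j < d ∧ w = rimNode k (p + j) := by
  have hp := Nat.mod_lt p (show 0 < 2 * k + 1 by omega)
  have hval : ∀ j, j < 2 * k + 1 → (rimNode k (p + j)).val =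
      if p % (2 * k + 1) + j < 2 * k + 1 then p % (2 * k + 1) + j + 1
      else p % (2 * k + 1) + j + 1 - (2 * k + 1) := by
    intro j hj
    rw [rimNode_val, ← Nat.mod_add_mod]
    split_ifs with h
    · rw [Nat.mod_eq_of_lt h]
    · rw [Nat.mod_eq_sub_mod (by omega), Nat.mod_eq_of_lt (by omega)]
      omega
  have h0 := rimNode_val k p
  have h1 := hval d hd
  by_cases hw : w = 0
  · subst hw
    refine ⟨fun h => absurd rfl h.1, ?_⟩
    rintro ⟨j, -, -, h⟩
    exact absurd h.symm (rimNode_ne_zero _ _)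
  have hwv : w.val ≠ 0 := fun h => hw (Fin.ext h)
  have hwlt := w.2
  simp only [InsideArc, ne_eq, hw, not_false_eq_true, true_and, Fin.lt_def]
  constructor
  · intro h
    refine ⟨if (rimNode k p).val < w.val then w.val - (rimNode k p).val
      else w.val + (2 * k + 1) - (rimNode k p).val, ?_⟩
    rw [Fin.ext_iff]
    split_ifs at h h1 ⊢ with h2 h3 h4 <;>
      (refine ⟨by omega, by omega, ?_⟩; rw [hval _ (by omega)]; split_ifs <;> omega)
  · rintro ⟨j, hj0, hj, rfl⟩
    rw [hval j (by omega)]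
    split_ifs at h1 ⊢ <;> omega

lemma mem_oddCentralCycles_iff {k : ℕ} {G : SimpleGraph (Fin (2 * k + 2))}
    {D : Set (Fin (2 * k + 2))} :
    D ∈ oddCentralCycles G ↔ ∃ p d, IsOddArc G p d ∧ D = arcNodes k p d := by
  have hD : ∀ p d, 0 < d → d < 2 * k + 1 → {w | w = 0 ∨ w = rimNode k p ∨
      w = rimNode k (p + d) ∨ InsideArc (rimNode k p) (rimNode k (p + d)) w} = arcNodes k p d := by
    intro p d hd0 hd
    ext w
    simp only [Set.mem_ofPred_eq, arcNodes, insideArc_rimNode_iff hd0 hd]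
    refine or_congr_right ⟨?_, ?_⟩
    · rintro (rfl | rfl | ⟨j, -, hj, rfl⟩)
      · exact ⟨0, by omega, rfl⟩
      · exact ⟨d, le_rfl, rfl⟩
      · exact ⟨j, hj.le, rfl⟩
    · rintro ⟨j, hj, rfl⟩
      rcases Nat.eq_zero_or_pos j with rfl | h0
      · exact Or.inl rfl
      · rcases hj.eq_or_lt with rfl | hj
        · exact Or.inr (Or.inl rfl)
        · exact Or.inr (Or.inr ⟨j, h0, hj, rfl⟩)
  constructor
  · rintro ⟨⟨u, v, ⟨hu, hv, huv, hno⟩, rfl⟩, hodd⟩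
    obtain ⟨p, rfl⟩ : ∃ p, u = rimNode k p :=
      ⟨_, (rimNode_rimIndex (s := 0) hu.ne').symm⟩
    obtain ⟨d, hd, rfl⟩ : ∃ d, d < 2 * k + 1 ∧ v = rimNode k (p + d) :=
      ⟨_, rimIndex_lt _ _ _, (rimNode_rimIndex hv.ne').symm⟩
    have hd0 : 0 < d := by
      rcases Nat.eq_zero_or_pos d with rfl | h
      · exact absurd rfl huv
      · exact h
    rw [hD p d hd0 hd] at hodd ⊢
    rw [ncard_arcNodes hd, Nat.odd_iff] at hodd
    refine ⟨p, d, ⟨hd, by omega, hu, hv, fun j hj0 hj hadj => ?_⟩, rfl⟩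
    exact hno _ hadj ((insideArc_rimNode_iff hd0 hd _).2 ⟨j, hj0, hj, rfl⟩)
  · rintro ⟨p, d, ⟨hd, hodd, hu, hv, hno⟩, rfl⟩
    have hd0 : 0 < d := by omega
    refine ⟨⟨rimNode k p, rimNode k (p + d), ⟨hu, hv, fun h => ?_, fun w hw hin => ?_⟩,
      (hD p d hd0 hd).symm⟩, ?_⟩
    · have := rimNode_add_inj (s := p) (m := 0) (by omega) hd h
      omega
    · obtain ⟨j, hj0, hj, rfl⟩ := (insideArc_rimNode_iff hd0 hd w).1 hin
      exact hno j hj0 hj hw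
    · rw [ncard_arcNodes hd, Nat.odd_iff]
      omega

/-! ### Counting odd arcs in the hole case. -/

section hole

variable {k : ℕ} {G : SimpleGraph (Fin (2 * k + 2))}

/-- A step of the walk that increases the count closes an odd arc. -/
lemma exists_isOddArc_of_walk {s m : ℕ} {b : ℕ → Prop} [DecidablePred b]
    (hb : ∀ m, b m ↔ G.Adj 0 (rimNode k (s + m))) (h0 : b 0) (hm : b (m + 1))
    (hw : (walk b m).2 = true) : ∃ r ≤ m, (m + 1 - r) % 2 = 1 ∧ (∀ j, r < j → j ≤ m → ¬ b j) ∧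
      (m + 1 - r < 2 * k + 1 → IsOddArc G (s + r) (m + 1 - r)) := by
  obtain ⟨r, hr, hr', hno, hodd⟩ := exists_odd_gap_of_walk hw
  refine ⟨r, hr, hodd, hno, fun hlt => ⟨hlt, hodd, ?_, ?_, fun j hj0 hj => ?_⟩⟩
  · rw [← hb]
    rcases hr' with h | rfl
    · exact h
    · exact h0
  · rwa [show s + r + (m + 1 - r) = s + (m + 1) by omega, ← hb]
  · rw [add_assoc, ← hb]
    exact hno _ (by omega) (by omega)

theorem isLSPlusPerfect_of_oddCentralCycles_ncard (hk : 2 ≤ k)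
    (hG : deleteZero G = cycleGraph (2 * k + 1)) (h1 : (oddCentralCycles G).ncard = 1) :
    IsLSPlusPerfect G := by
  classical
  obtain ⟨D, hD⟩ := Set.ncard_eq_one.1 h1
  have huniq : ∀ p d, IsOddArc G p d → arcNodes k p d = D := fun p d h => by
    have : arcNodes k p d ∈ oddCentralCycles G := mem_oddCentralCycles_iff.2 ⟨p, d, h, rfl⟩
    rwa [hD] at this
  obtain ⟨p, d, hpd, -⟩ := mem_oddCentralCycles_iff.1 (hD ▸ Set.mem_singleton D)
  have hDp := huniq p d hpd
  obtain ⟨hd, hdodd, hp, hpd', hno⟩ := hpd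
  have hend : ∀ v ∈ D, G.Adj 0 v → v = rimNode k p ∨ v = rimNode k (p + d) := by
    intro v hv hadj
    rw [← hDp] at hv
    rcases hv with rfl | ⟨j, hj, rfl⟩
    · exact absurd rfl hadj.ne
    · rcases Nat.eq_zero_or_pos j with rfl | h0
      · exact Or.inl rfl
      · rcases hj.eq_or_lt with rfl | hj
        · exact Or.inr rfl
        · exact absurd hadj (hno j h0 hj)
  -- The deleted node is the end of the unique odd arc. A counted mark would close an odd arc with
  -- the same node set `D`, hence one running from `p + d` back to `p`; the two odd lengths would
  -- then add up to `2k+1`.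
  refine isLSPlusPerfect_of_walk hk hG (s := p + d)
    (b := fun m => G.Adj 0 (rimNode k (p + d + m))) (fun m => Iff.rfl) fun m hm hbm => ?_
  by_contra hw
  rw [Bool.not_eq_false] at hw
  obtain ⟨r, hr, hodd, -, harc⟩ := exists_isOddArc_of_walk (s := p + d) (fun m => Iff.rfl) hpd' hbm hw
  have harc := harc (by omega)
  have hD' := huniq _ _ harc
  have hm1 : p + d + r + (m + 1 - r) = p + d + (m + 1) := by omega
  have e1 : rimNode k (p + d + (m + 1)) = rimNode k p := by
    refine (hend _ ?_ hbm).resolve_right fun h => ?_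
    · rw [← hD']
      exact Or.inr ⟨m + 1 - r, le_rfl, by rw [hm1]⟩
    · have := rimNode_add_inj (m' := 0) (by omega) (by omega) h
      omega
  have e2 : rimNode k (p + d + r) = rimNode k (p + d) := by
    refine (hend _ ?_ harc.2.2.1).resolve_left fun h => ?_
    · rw [← hD']
      exact Or.inr ⟨0, by omega, rfl⟩
    · have := rimNode_add_inj (by omega) (by omega) (h.trans e1.symm)
      omega
  have hr0 : r = 0 := rimNode_add_inj (s := p + d) (m' := 0) (by omega) (by omega) e2
  rw [add_assoc, rimNode_eq_iff] at e1
  have h3 : d + (m + 1) ≡ 0 [MOD 2 * k + 1] := Nat.ModEq.add_left_cancel' p e1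
  have h4 := (Nat.modEq_zero_iff_dvd.1 h3)
  obtain ⟨c, hc⟩ := h4
  have hc1 : c = 1 := by
    rcases c with _ | _ | c
    · omega
    · rfl
    · nlinarith
  rw [hc1] at hc
  omega

theorem isLSPlusPerfect_of_degree_le_one [DecidableRel G.Adj] (hk : 2 ≤ k)
    (hG : deleteZero G = cycleGraph (2 * k + 1)) (h : G.degree 0 ≤ 1) : IsLSPlusPerfect G := by
  classical
  obtain ⟨s, hs⟩ : ∃ s, ∀ m, 0 < m → m < 2 * k + 1 → ¬ G.Adj 0 (rimNode k (s + m)) := by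
    by_cases h0 : ∃ s, G.Adj 0 (rimNode k s)
    · obtain ⟨s, hs⟩ := h0
      refine ⟨s, fun m hm0 hm hadj => ?_⟩
      rw [← card_neighborFinset_eq_degree, Finset.card_le_one] at h
      have := h _ ((mem_neighborFinset _ _ _).2 hadj) _ ((mem_neighborFinset _ _ _).2 hs)
      have := rimNode_add_inj (s := s) (m' := 0) hm (by omega) this
      omega
    · push Not at h0
      exact ⟨0, fun m _ _ => h0 _⟩
  refine isLSPlusPerfect_of_walk hk hG (s := s) (b := fun m => G.Adj 0 (rimNode k (s + m)))
    (fun m => Iff.rfl) fun m hm hbm => ?_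
  exact absurd hbm (hs (m + 1) (by omega) (by omega))

/-- Without odd arcs the count stays 0 for a full turn starting at a neighbour of `0`, yet the value
there is `true` again, contradicting parity after `2k+1` steps. The second neighbour `v` rules out
an arc of full length. -/
lemma exists_isOddArc [DecidableRel G.Adj] (h : 2 ≤ G.degree 0) : ∃ p d, IsOddArc G p d := by
  classical
  rw [← card_neighborFinset_eq_degree] at h
  obtain ⟨u, hu, v, hv, huv⟩ := Finset.one_lt_card.1 h
  rw [mem_neighborFinset] at hu hv
  obtain ⟨s, rfl⟩ : ∃ s, u = rimNode k s := ⟨_, (rimNode_rimIndex (s := 0) hu.ne').symm⟩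
  obtain ⟨t, ht, rfl⟩ : ∃ t, t < 2 * k + 1 ∧ v = rimNode k (s + t) :=
    ⟨_, rimIndex_lt _ _ _, (rimNode_rimIndex hv.ne').symm⟩
  have ht0 : 0 < t := by
    rcases Nat.eq_zero_or_pos t with rfl | h
    · exact absurd rfl huv
    · exact h
  by_contra! hno
  let b : ℕ → Prop := fun m => G.Adj 0 (rimNode k (s + m))
  have hcount : ∀ m, m ≤ 2 * k + 1 → (walk b m).1 = 0 := by
    intro m hm
    induction m with
    | zero => rfl
    | succ m ih =>
      rcases walk_succ_cases (b := b) m with h | ⟨h1, h2, -⟩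
      · rw [h]
        exact ih (by omega)
      · exfalso
        obtain ⟨r, hr, hodd, hnb, harc⟩ := exists_isOddArc_of_walk (fun m => Iff.rfl) hu h1 h2
        refine hno _ _ (harc ?_)
        by_contra hlt
        exact hnb t (by omega) (by omega) hv
  have h1 := walk_parity (b := b) (2 * k + 1)
  have h2 : b (2 * k + 1) := by
    change G.Adj 0 _
    rwa [rimNode_add_period]
  rw [hcount _ le_rfl, walk_snd_of_mark (Or.inl h2)] at h1
  simp only [if_true] at h1
  omega

/-- An odd arc is counted by the walk that starts at a nonneighbour of `0` and marks its last
position. -/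
lemma exists_count_of_isOddArc {s : ℕ} {b : ℕ → Prop} [DecidablePred b]
    (hb : ∀ m, b m ↔ (G.Adj 0 (rimNode k (s + m)) ∨ m = 2 * k))
    (h0 : ¬ G.Adj 0 (rimNode k s)) (h1 : G.Adj 0 (rimNode k (s + 1))) {r d : ℕ}
    (hr : r < 2 * k + 1) (harc : IsOddArc G (s + r) d) :
    ∃ q, r < q ∧ q ≤ r + d ∧ q ≤ 2 * k ∧ (walk b q).1 = (walk b r).1 + 1 := by
  obtain ⟨hd, hodd, hr', hrd, hno⟩ := harc
  have hmark : (walk b r).2 = true := walk_snd_of_mark (Or.inl ((hb r).2 (Or.inl hr')))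
  have hnob : ∀ j, r < j → j < r + d → j < 2 * k → ¬ b j := by
    intro j hj hj' hjk hbj
    have h2 := ((hb j).1 hbj).resolve_right (by omega)
    refine hno (j - r) (by omega) (by omega) ?_
    rwa [add_assoc, show r + (j - r) = j by omega]
  by_cases hle : r + d ≤ 2 * k
  · refine ⟨r + d, by omega, le_rfl, hle, walk_fst_of_odd hmark ((hb _).2 (Or.inl ?_)) (by omega)
      (by omega) fun j hj hj' => hnob j hj hj' (by omega)⟩
    rwa [← add_assoc]
  -- An arc passing position `2k` cannot end at `s` and cannot pass `s + 1`, so it ends at position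
  -- `2k + 2`. Its part up to `2k` is again odd, which is why the extra mark there counts it.
  · have hne : r + d ≠ 2 * k + 1 := fun h => by
      rw [add_assoc, h, rimNode_add_period] at hrd
      exact h0 hrd
    have hle' : r + d ≤ 2 * k + 2 := by
      by_contra hlt
      refine hno (2 * k + 2 - r) (by omega) (by omega) ?_
      rwa [show s + r + (2 * k + 2 - r) = s + 1 + (2 * k + 1) by omega, rimNode_add_period]
    exact ⟨2 * k, by omega, by omega, le_rfl, walk_fst_of_odd hmark ((hb _).2 (Or.inr rfl))
      (by omega) (by omega) fun j hj hj' => hnob j hj (by omega) hj'⟩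

/-- The mark at position 1 is counted, and each of the two arcs adds one further count. The arcs do
not overlap, since no neighbour of `0` lies inside an arc. -/
lemma three_le_walk {s : ℕ} {b : ℕ → Prop} [DecidablePred b]
    (hb : ∀ m, b m ↔ (G.Adj 0 (rimNode k (s + m)) ∨ m = 2 * k))
    (h0 : ¬ G.Adj 0 (rimNode k s)) (h1 : G.Adj 0 (rimNode k (s + 1))) {r d r' d' : ℕ} (hr0 : 0 < r)
    (hrr : r < r') (hr : r' < 2 * k + 1) (harc : IsOddArc G (s + r) d)
    (harc' : IsOddArc G (s + r') d') : 3 ≤ (walk b (2 * k)).1 := by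
  obtain ⟨q, hrq, hqd, -, hq⟩ := exists_count_of_isOddArc hb h0 h1 (by omega) harc
  obtain ⟨q', -, -, hqk', hq'⟩ := exists_count_of_isOddArc hb h0 h1 hr harc'
  have hqr : q ≤ r' := by
    by_contra hlt
    refine harc.2.2.2.2 (r' - r) (by omega) (by omega) ?_
    rw [add_assoc, show r + (r' - r) = r' by omega]
    exact harc'.2.2.1
  have e1 : (walk b 1).1 = 1 := by
    rw [walk_succ_of_true ((hb 1).2 (Or.inl h1)) rfl]
    rfl
  have m1 : (walk b 1).1 ≤ (walk b r).1 := walk_fst_mono (by omega : 1 ≤ r)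
  have m2 : (walk b q).1 ≤ (walk b r').1 := walk_fst_mono hqr
  have m3 : (walk b q').1 ≤ (walk b (2 * k)).1 := walk_fst_mono hqk'
  omega

theorem not_isLSPlusPerfect_of_oddCentralCycles_ncard [DecidableRel G.Adj] (hk : 2 ≤ k)
    (hG : deleteZero G = cycleGraph (2 * k + 1)) (hdeg : 2 ≤ G.degree 0)
    (hdeg' : G.degree 0 ≠ 2 * k + 1) (hne : (oddCentralCycles G).ncard ≠ 1) :
    ¬ IsLSPlusPerfect G := by
  classical
  obtain ⟨p₁, d₁, harc₁⟩ := exists_isOddArc hdeg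
  obtain ⟨p₂, d₂, harc₂, hD⟩ : ∃ p₂ d₂, IsOddArc G p₂ d₂ ∧ arcNodes k p₂ d₂ ≠ arcNodes k p₁ d₁ := by
    by_contra! h
    refine hne (Set.ncard_eq_one.2 ⟨arcNodes k p₁ d₁, ?_⟩)
    ext D
    rw [mem_oddCentralCycles_iff, Set.mem_singleton_iff]
    constructor
    · rintro ⟨p, d, hpd, rfl⟩
      exact h p d hpd
    · rintro rfl
      exact ⟨p₁, d₁, harc₁, rfl⟩
  -- As `0` has both neighbours and nonneighbours on the cycle, some nonneighbour is followed by a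
  -- neighbour.
  obtain ⟨s, h0, h1⟩ : ∃ s, ¬ G.Adj 0 (rimNode k s) ∧ G.Adj 0 (rimNode k (s + 1)) := by
    obtain ⟨w, hw⟩ := exists_not_adj_zero_of_degree_ne hdeg'
    have hw' : rimNode k (w.val + 0) = w.succ := by
      rw [Fin.ext_iff, rimNode_val, add_zero, Nat.mod_eq_of_lt w.2, Fin.val_succ]
    by_contra! h
    have hall : ∀ m, ¬ G.Adj 0 (rimNode k (w.val + m)) := by
      intro m
      induction m with
      | zero => rwa [hw']
      | succ m ih => exact h _ ih
    have := hall (rimIndex k w.val (rimNode k p₁))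
    rw [rimNode_rimIndex (rimNode_ne_zero _ _)] at this
    exact this harc₁.2.2.1
  have hshift : ∀ p d, IsOddArc G p d → ∃ r, 0 < r ∧ r < 2 * k + 1 ∧ IsOddArc G (s + r) d ∧
      ∀ d, arcNodes k p d = arcNodes k (s + r) d := by
    intro p d harc
    have e := rimNode_rimIndex (s := s) (rimNode_ne_zero k p)
    have e' := rimNode_add_congr e
    refine ⟨rimIndex k s (rimNode k p), ?_, rimIndex_lt _ _ _, ?_, fun d => ?_⟩
    · by_contra hr
      rw [show rimIndex k s (rimNode k p) = 0 by omega, add_zero] at e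
      exact h0 (e ▸ harc.2.2.1)
    · simpa only [IsOddArc, e, e'] using harc
    · simp only [arcNodes, e']
  obtain ⟨r₁, hr₁, hr₁', ha₁, hn₁⟩ := hshift _ _ harc₁
  obtain ⟨r₂, hr₂, hr₂', ha₂, hn₂⟩ := hshift _ _ harc₂
  let b : ℕ → Prop := fun m => G.Adj 0 (rimNode k (s + m)) ∨ m = 2 * k
  have hb : ∀ m, b m ↔ (G.Adj 0 (rimNode k (s + m)) ∨ m = 2 * k) := fun m => Iff.rfl
  refine not_isLSPlusPerfect_of_walk hk hG hb h0 (Or.inl h1) ?_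
  rcases lt_trichotomy r₁ r₂ with h | h | h
  · exact three_le_walk hb h0 h1 hr₁ h hr₂' ha₁ ha₂
  · exfalso
    subst h
    refine hD ?_
    -- Arcs with the same start agree: each ends at the first neighbour of `0` that follows.
    have hd : d₁ = d₂ := by
      rcases lt_trichotomy d₁ d₂ with h | h | h
      · exact absurd ha₁.2.2.2.1 (ha₂.2.2.2.2 d₁ (by have := ha₁.2.1; omega) h)
      · exact h
      · exact absurd ha₂.2.2.2.1 (ha₁.2.2.2.2 d₂ (by have := ha₂.2.1; omega) h)
    rw [hn₁, hn₂, hd]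
  · exact three_le_walk hb h0 h1 hr₂ h hr₁' ha₂ ha₁

end hole

theorem mainTheorem8 (k : ℕ) (hk : 2 ≤ k) (G : SimpleGraph (Fin (2 * k + 2)))
    [DecidableRel G.Adj] (hG : IsMinimallyImperfect (deleteZero G)) :
    (deleteZero G = cycleGraph (2 * k + 1) →
      (IsLSPlusPerfect G ↔
        (2 ≤ G.degree 0 ∧ (oddCentralCycles G).ncard = 1) ∨
          (G.degree 0 = 0 ∨ G.degree 0 = 1 ∨ G.degree 0 = 2 * k + 1))) ∧
    (deleteZero G = (cycleGraph (2 * k + 1))ᶜ → G.indepNum = 2 →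
      (IsLSPlusPerfect G ↔ G.degree 0 = 2 * k + 1)) := by
  refine ⟨fun hC => ⟨fun hp => ?_, ?_⟩, fun hC hα => ⟨fun hp => ?_, fun hd => ?_⟩⟩
  · by_contra! h
    exact not_isLSPlusPerfect_of_oddCentralCycles_ncard hk hC (by omega) h.2.2.2
      (h.1 (by omega)) hp
  · rintro (⟨-, h⟩ | h | h | h)
    · exact isLSPlusPerfect_of_oddCentralCycles_ncard hk hC h
    · exact isLSPlusPerfect_of_degree_le_one hk hC (by omega)
    · exact isLSPlusPerfect_of_degree_le_one hk hC (by omega)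
    · exact isLSPlusPerfect_of_wheel hk hC (adj_zero_of_degree_eq h)
  · by_contra hd
    obtain ⟨w, hw⟩ := exists_not_adj_zero_of_degree_ne hd
    exact not_isLSPlusPerfect_of_antihole hk hC hα hw hp
  · exact isLSPlusPerfect_of_antiwheel hk hC (adj_zero_of_degree_eq hd)
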